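/- Let $n,m\ge 0$, let $\mathbb{F}_q$ be a finite field with $q$ elements, and let $\tilde B$ be an $(n+m)\times n$ extended exchange matrix, i.e. an integer matrix whose top $n\times n$ part is skew-symmetric. Let $(\mathbf{x},\tilde B)$ be a seed over $\mathbb{F}_q$, where $\mathbf{x}=(x_1,\dots,x_{n+m})$ freely generates a field $\mathcal{F}\cong\mathbb{F}_q(t_1,\dots,t_{n+m})$ over $\mathbb{F}_q$, with $x_1,\dots,x_n$ mutable and $x_{n+1},\dots,x_{n+m}$ frozen. Mutation of a seed at $k\in\{1,\dots,n\}$ replaces $x_k$ by $x_k'=x_k^{-1}\bigl(\prod_i x_i^{[\tilde B_{ik}]_+}+\prod_i x_i^{[-\tilde B_{ik}]_+}\bigr)$, keeps the other $x_i$, and replaces $\tilde B$ by the matrix $\tilde B'$ with $\tilde B'_{ij}=-\tilde B_{ij}$ if $i=k$ or $j=k$, and $\tilde B'_{ij}=\tilde B_{ij}+[\tilde B_{ik}]_+[\tilde B_{kj}]_+-[\tilde B_{ik}]_-[\tilde B_{kj}]_-$ otherwise, where $[a]_+=\max(a,0)$ and $[a]_-=\min(a,0)$. Let $A\subseteq\mathcal{F}$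 be the cluster algebra over $\mathbb{F}_q$: the $\mathbb{F}_q$-subalgebra generated by the elements of all seeds obtained from $(\mathbf{x},\tilde B)$ by sequences of mutations, and by the inverses of the frozen variables. Let $\mathcal{A}=\operatorname{Spec}A$ be the cluster variety, so that $\mathcal{A}(\mathbb{F}_q)$ is the set of $\mathbb{F}_q$-algebra homomorphisms $A\to\mathbb{F}_q$. Assume that $\mathcal{A}$ is of really full rank, i.e. the rows of $\tilde B$ span $\mathbb{Z}^n$ over $\mathbb{Z}$, and that $\mathcal{A}$ is acyclic, i.e. some seed obtained from $(\mathbf{x},\tilde B)$ by a sequence of mutations has an acyclic quiver, where the quiver of a seed with matrix $C$ has vertices $1,\dots,n$ and an arrow $i\to j$ whenever $C_{ij}>0$. For any such acyclic seed, let $\Gamma$ be the undirected graph underlying its quiver and let $\mathcal{I}_k$ be the set of $k$-element anticliques (independent sets of vertices) of $\Gamma$. Then $$\#\mathcal{A}(\mathbb{F}_q)=\sum_{k=0}^{n}|\mathcal{I}_k|\,q^k\,(q-1)^{n+m-2k}.$$ -/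

import Mathlib

namespace ClusterAlg

/-- An `(n+m) × n` integer matrix. Rows `Sum.inl i` are the mutable rows, rows `Sum.inr j` are the
frozen rows. -/
abbrev ExtMatrix (n m : ℕ) := Matrix (Fin n ⊕ Fin m) (Fin n) ℤ

/-- `B` is an extended exchange matrix: its top square part is skew-symmetric. -/
def IsExtendedExchange {n m : ℕ} (B : ExtMatrix n m) : Prop :=
  ∀ i j : Fin n, B (Sum.inl i) j = -B (Sum.inl j) i

/-- Matrix mutation in direction `k`, where `[x]₊ = max x 0` and `[x]₋ = min x 0`. -/
def mutateMatrix {n m : ℕ} (B : ExtMatrix n m) (k : Fin n) : ExtMatrix n m :=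
  fun i j =>
    if i = Sum.inl k ∨ j = k then -B i j
    else B i j + max (B i k) 0 * max (B (Sum.inl k) j) 0
      - min (B i k) 0 * min (B (Sum.inl k) j) 0

/-- The rows of `B` span `ℤⁿ` over `ℤ`. -/
def IsReallyFullRank {n m : ℕ} (B : ExtMatrix n m) : Prop :=
  Submodule.span ℤ (Set.range B.row) = ⊤

/-- The arrows `i ⟶ j` of the quiver of `B` on the mutable vertices. -/
def quiverRel {n m : ℕ} (B : ExtMatrix n m) (i j : Fin n) : Prop :=
  0 < B (Sum.inl i) j

/-- The quiver of `B` has no oriented cycle. -/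
def IsAcyclic {n m : ℕ} (B : ExtMatrix n m) : Prop :=
  ∀ i : Fin n, ¬ Relation.TransGen (quiverRel B) i i

/-- The undirected graph underlying the quiver of `B`. -/
def quiverGraph {n m : ℕ} (B : ExtMatrix n m) : SimpleGraph (Fin n) :=
  SimpleGraph.fromRel (quiverRel B)

/-- The set of anticliques (independent sets) with `k` elements in the graph of `B`. -/
def anticliques {n m : ℕ} (B : ExtMatrix n m) (k : ℕ) : Set (Finset (Fin n)) :=
  {I | (quiverGraph B).IsNIndepSet k I}

/-- The data of a labelled seed in a field `F`: the elements `x₁, …, xₙ` (mutable, `Sum.inl`) and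
`xₙ₊₁, …, xₙ₊ₘ` (frozen, `Sum.inr`) and a matrix. -/
structure SeedData (F : Type*) (n m : ℕ) where
  x : Fin n ⊕ Fin m → F
  B : ExtMatrix n m

/-- `t` is a seed over the ground field `K`: the matrix is an extended exchange matrix and the
`n + m` elements freely generate `F` as a field over `K`
(so that `F` is isomorphic to `K(t₁, …, tₙ₊ₘ)`). -/
structure SeedData.IsSeed (K : Type*) {F : Type*} [Field K] [Field F] [Algebra K F] {n m : ℕ}
    (t : SeedData F n m) : Prop where
  exchange : IsExtendedExchange t.B
  algebraicIndependent : AlgebraicIndependent K t.x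
  generates : IntermediateField.adjoin K (Set.range t.x) = ⊤

/-- Seed mutation in direction `k`. Note that `z.toNat = max z 0` for an integer `z`. -/
def SeedData.mutate {F : Type*} [Field F] {n m : ℕ} (t : SeedData F n m) (k : Fin n) :
    SeedData F n m where
  x := Function.update t.x (Sum.inl k)
    ((∏ i, t.x i ^ (t.B i k).toNat + ∏ i, t.x i ^ (-t.B i k).toNat) / t.x (Sum.inl k))
  B := mutateMatrix t.B k

/-- `t'` is obtained from `t` by a finite sequence of mutations. -/
def SeedData.MutatesTo {F : Type*} [Field F] {n m : ℕ} (t t' : SeedData F n m) : Prop :=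
  Relation.ReflTransGen (fun s s' : SeedData F n m => ∃ k : Fin n, s' = s.mutate k) t t'

/-- The cluster algebra over `K` of a seed: the `K`-subalgebra of `F` generated by all the cluster
variables (mutable and frozen) and the inverses of the frozen variables. -/
def SeedData.clusterAlgebra (K : Type*) {F : Type*} [Field K] [Field F] [Algebra K F] {n m : ℕ}
    (t : SeedData F n m) : Subalgebra K F :=
  Algebra.adjoin K
    ({z : F | ∃ t' : SeedData F n m, t.MutatesTo t' ∧ ∃ i, z = t'.x i} ∪
      {z : F | ∃ j : Fin m, z = (t.x (Sum.inr j))⁻¹})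

/-- The `K`-rational points of the cluster variety `Spec A`, for `A` the cluster algebra over `K`:
the `K`-algebra homomorphisms `A → K`. -/
abbrev SeedData.ClusterVarietyPoints (K : Type*) {F : Type*} [Field K] [Field F] [Algebra K F]
    {n m : ℕ} (t : SeedData F n m) : Type _ :=
  t.clusterAlgebra K →ₐ[K] K

end ClusterAlg

/-!
Points of an acyclic cluster variety of really full rank over a finite field with `q` elements.

Let `x` be the variables of an acyclic seed and `xₖ'` the mutations of its mutable variables. The
points of the cluster variety turn out to be the solutions `(a, a')` over `K` of the exchange
relations `xₖ xₖ' = Pₖ(x)` with nonvanishing frozen coordinates (`IsFullRankSeed.card_algHom`).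
These are counted according to the set `S` of vanishing mutable coordinates. If two vertices of `S`
were joined, then at a source of the quiver restricted to `S` (ignoring isolated vertices) one
monomial of the exchange polynomial would vanish and the other one would not; so `S` is independent
(`isIndependent_of_exchange`). For independent `S` with `k` elements the coordinates `a'` at `S` are
free, which gives `q ^ k`, the other `a'` are determined, and the `n + m - k` nonzero coordinates
of `a` lie in a fiber of the homomorphism of tori given by the columns of the matrix in `S`. The
matrix has a left inverse, so this homomorphism is surjective and each of its fibers has
`(q - 1) ^ (n + m - 2 * k)` elements.

The description of the points does not use a presentation of the cluster algebra `A`. Its main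
ingredient is the inclusion of `A` in the upper bound of every seed
(`clusterAlgebra_le_upperBound`): the intersection of the Laurent rings of a seed and of its
mutations does not change under mutation. This reduces to two directions `j ≠ k`, where an element
has two denominators in the Laurent ring of the seed mutated at `k` and then at `j`, one of them a
nonzero divisor modulo the other (`mem_mutate_mutate`). If `j` and `k` are not joined, this is the
coprimality of two exchange polynomials, which holds because the matrix has a left inverse; if they
are joined, it follows from the exchange relations (`isRegularMod_of_exchange`). Both cases rest on
one statement about graded rings, `dvd_of_dvd_single_add_mul`.

For an independent set `S`, the upper bound is contained in the algebra generated by `x`, the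
inverses of the `xᵢ` with `i ∉ S` and the `xᵢ'` with `i ∈ S` (`upperBound_le_partialAlgebra`). Hence
a point of `A` with vanishing set `S` is determined by its values on the variables `x` and `x'`.
Conversely, a solution with vanishing set `S` is the limit of a formal curve of solutions without
vanishing mutable coordinates (`exists_curve`). Such a curve is a point of the Laurent ring over
the fraction field of `K⟦X⟧`; on `A` it takes values in `K⟦X⟧`, and its constant coefficient is the
required point (`exists_algHom_of_specialization`).
-/

/-! ### Matrix mutation and full rank -/

namespace ClusterAlg

section MatrixMutation

variable {n m : ℕ}

lemma max_neg_zero_eq (a : ℤ) : max (-a) 0 = - min a 0 := by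
  rcases le_total a 0 with h | h <;> simp [h]

lemma min_neg_zero_eq (a : ℤ) : min (-a) 0 = - max a 0 := by
  rcases le_total a 0 with h | h <;> simp [h]

lemma IsExtendedExchange.diag {B : ExtMatrix n m} (h : IsExtendedExchange B) (i : Fin n) :
    B (Sum.inl i) i = 0 := by
  have := h i i
  omega

lemma IsExtendedExchange.mutate {B : ExtMatrix n m} (h : IsExtendedExchange B) (k : Fin n) :
    IsExtendedExchange (mutateMatrix B k) := by
  intro i j
  have h1 := h i j
  have h2 := h i k
  have h3 := h k j
  simp only [mutateMatrix, Sum.inl.injEq]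
  by_cases hi : i = k
  · simp [hi, h3]
  by_cases hj : j = k
  · simp [hj, h2]
  simp only [hi, hj, or_self, if_false]
  rw [h1, h2, h3]
  rw [max_neg_zero_eq, max_neg_zero_eq, min_neg_zero_eq, min_neg_zero_eq]
  ring

lemma mutateMatrix_apply_col (B : ExtMatrix n m) (k : Fin n) (i : Fin n ⊕ Fin m) :
    mutateMatrix B k i k = - B i k := by simp [mutateMatrix]

lemma mutateMatrix_apply_row (B : ExtMatrix n m) (k j : Fin n) :
    mutateMatrix B k (Sum.inl k) j = - B (Sum.inl k) j := by simp [mutateMatrix]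

lemma mutateMatrix_mutateMatrix (B : ExtMatrix n m) (k : Fin n) :
    mutateMatrix (mutateMatrix B k) k = B := by
  ext i j
  by_cases hi : i = Sum.inl k
  · subst hi; simp [mutateMatrix_apply_row]
  by_cases hj : j = k
  · subst hj; simp [mutateMatrix_apply_col]
  rw [mutateMatrix]
  simp only [hi, hj, or_self, if_false, mutateMatrix_apply_row, mutateMatrix_apply_col]
  simp only [mutateMatrix, hi, hj, or_self, if_false]
  rw [max_neg_zero_eq, max_neg_zero_eq, min_neg_zero_eq, min_neg_zero_eq]
  ring

lemma mutateMatrix_neg (B : ExtMatrix n m) (k : Fin n) :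
    mutateMatrix (-B) k = - mutateMatrix B k := by
  ext i j
  simp only [mutateMatrix, Matrix.neg_apply]
  split_ifs
  · rfl
  · rw [max_neg_zero_eq, max_neg_zero_eq, min_neg_zero_eq, min_neg_zero_eq]; ring

/-- A left inverse of the extended exchange matrix: the form in which the full rank condition is
used. -/
def HasLeftInverse (B : ExtMatrix n m) : Prop :=
  ∃ C : Matrix (Fin n) (Fin n ⊕ Fin m) ℤ, C * B = 1

lemma IsReallyFullRank.hasLeftInverse {B : ExtMatrix n m} (h : IsReallyFullRank B) :
    HasLeftInverse B := by
  have (l : Fin n) : ∃ c : Fin n ⊕ Fin m → ℤ, ∑ i, c i • B.row i = Pi.single l 1 := by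
    apply (Submodule.mem_span_range_iff_exists_fun ℤ).1
    rw [h]; trivial
  choose c hc using this
  refine ⟨Matrix.of c, ?_⟩
  ext l j
  have := congrFun (hc l) j
  simp only [Finset.sum_apply, Pi.smul_apply, Matrix.row, smul_eq_mul] at this
  rw [Matrix.mul_apply]
  simp only [Matrix.of_apply]
  rw [this, Matrix.one_apply, Pi.single_apply]
  simp [eq_comm]

lemma HasLeftInverse.neg {B : ExtMatrix n m} (h : HasLeftInverse B) : HasLeftInverse (-B) := by
  obtain ⟨C, hC⟩ := h
  exact ⟨-C, by simpa using hC⟩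

/-- Matrix mutation is multiplication on both sides by involutions, so it preserves the full rank
condition. -/
lemma HasLeftInverse.mutate {B : ExtMatrix n m} (hB : IsExtendedExchange B)
    (h : HasLeftInverse B) (k : Fin n) : HasLeftInverse (mutateMatrix B k) := by
  classical
  obtain ⟨C, hC⟩ := h
  set E : Matrix (Fin n ⊕ Fin m) (Fin n ⊕ Fin m) ℤ :=
    Matrix.updateCol 1 (Sum.inl k) (fun i => if i = Sum.inl k then -1 else max (B i k) 0) with hE
  set G : Matrix (Fin n) (Fin n) ℤ :=
    Matrix.updateRow 1 k (fun j => if j = k then -1 else max (- B (Sum.inl k) j) 0) with hG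
  have hEmul (M : ExtMatrix n m) (i j) : (E * M) i j =
      if i = Sum.inl k then - M (Sum.inl k) j else M i j + max (B i k) 0 * M (Sum.inl k) j := by
    rw [Matrix.mul_apply]
    have : ∀ l, E i l * M l j = (if l = i then (if l = Sum.inl k then 0 else M l j) else 0) +
        (if l = Sum.inl k then
          (if i = Sum.inl k then -1 else max (B i k) 0) * M (Sum.inl k) j else 0) := by
      intro l
      rw [hE, Matrix.updateCol_apply, Matrix.one_apply]
      by_cases h1 : l = Sum.inl k
      · subst h1; simp
      · by_cases h2 : l = i
        · subst h2; simp [h1]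
        · simp [h1, h2, Ne.symm h2]
    rw [Finset.sum_congr rfl fun l _ => this l, Finset.sum_add_distrib]
    simp only [Finset.sum_ite_eq', Finset.mem_univ, if_true]
    split_ifs <;> ring
  have hGmul {α : Type} (M : Matrix α (Fin n) ℤ) (i j) : (M * G) i j =
      if j = k then - M i k else M i j + M i k * max (- B (Sum.inl k) j) 0 := by
    rw [Matrix.mul_apply]
    have : ∀ l, M i l * G l j = (if l = j then (if l = k then 0 else M i l) else 0) +
        (if l = k then M i k * (if j = k then -1 else max (- B (Sum.inl k) j) 0) else 0) := by
      intro l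
      rw [hG, Matrix.updateRow_apply, Matrix.one_apply]
      by_cases h1 : l = k
      · subst h1; simp
      · by_cases h2 : l = j
        · subst h2; simp [h1]
        · simp [h1, h2]
    rw [Finset.sum_congr rfl fun l _ => this l, Finset.sum_add_distrib]
    simp only [Finset.sum_ite_eq', Finset.mem_univ, if_true]
    split_ifs <;> ring
  have hkk := hB.diag k
  have hmut : mutateMatrix B k = E * (B * G) := by
    ext i j
    rw [hEmul]
    simp only [hGmul, mutateMatrix, hkk]
    by_cases hi : i = Sum.inl k
    · subst hi
      by_cases hj : j = k
      · subst hj; simp [hkk]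
      · simp [hj]
    · by_cases hj : j = k
      · simp [hi, hj]
      · simp only [hi, hj, or_self, if_false]
        rcases le_total (B i k) 0 with h1 | h1 <;>
          rcases le_total (B (Sum.inl k) j) 0 with h2 | h2 <;>
          simp [h1, h2, sub_eq_add_neg]
  have hEE (M : ExtMatrix n m) : E * (E * M) = M := by
    ext i j
    simp only [hEmul]
    split_ifs <;> simp_all
  have hGG : G * G = 1 := by
    ext i j
    rw [hGmul, hG]
    simp only [Matrix.updateRow_apply, Matrix.one_apply]
    by_cases hi : i = k
    · subst hi
      by_cases hj : j = i
      · subst hj; simp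
      · simp [hj, Ne.symm hj]
    · by_cases hj : j = k
      · subst hj; simp [hi]
      · simp [hi, hj]
  refine ⟨G * C * E, ?_⟩
  rw [hmut, Matrix.mul_assoc (G * C), hEE, Matrix.mul_assoc G, ← Matrix.mul_assoc C, hC,
    Matrix.one_mul, hGG]

end MatrixMutation

/-! ### Laurent polynomials -/

section LaurentSubalgebra

variable {K F ι : Type*} [Field K] [Field F] [Algebra K F]

variable (K) in
/-- The subalgebra of Laurent polynomials in the elements `x`. -/
def laurentSubalgebra (x : ι → F) : Subalgebra K F :=
  Algebra.adjoin K (Set.range x ∪ Set.range fun i => (x i)⁻¹)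

lemma mem_laurentSubalgebra (x : ι → F) (i : ι) : x i ∈ laurentSubalgebra K x :=
  Algebra.subset_adjoin (Or.inl ⟨i, rfl⟩)

lemma inv_mem_laurentSubalgebra (x : ι → F) (i : ι) : (x i)⁻¹ ∈ laurentSubalgebra K x :=
  Algebra.subset_adjoin (Or.inr ⟨i, rfl⟩)

lemma zpow_mem_of_inv_mem {L : Subalgebra K F} {a : F} (h : a ∈ L) (h' : a⁻¹ ∈ L) (z : ℤ) :
    a ^ z ∈ L := by
  rcases Int.eq_nat_or_neg z with ⟨k, rfl | rfl⟩
  · simpa using pow_mem h k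
  · simpa [← inv_pow] using pow_mem h' k

end LaurentSubalgebra

section LaurentMonomials

variable {K F ι : Type*} [Field K] [Field F] [Algebra K F] [Fintype ι]

/-- The Laurent monomial `∏ i, x i ^ β i`. -/
def laurentMonomial (x : ι → F) (β : ι → ℤ) : F := ∏ i, x i ^ β i

lemma laurentMonomial_zero (x : ι → F) : laurentMonomial x 0 = 1 := by simp [laurentMonomial]

lemma laurentMonomial_add {x : ι → F} (hx : ∀ i, x i ≠ 0) (β γ : ι → ℤ) :
    laurentMonomial x (β + γ) = laurentMonomial x β * laurentMonomial x γ := by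
  simp [laurentMonomial, zpow_add₀ (hx _), Finset.prod_mul_distrib]

lemma laurentMonomial_ne_zero {x : ι → F} (hx : ∀ i, x i ≠ 0) (β : ι → ℤ) :
    laurentMonomial x β ≠ 0 :=
  Finset.prod_ne_zero_iff.2 fun i _ => zpow_ne_zero _ (hx i)

lemma laurentMonomial_neg {x : ι → F} (β : ι → ℤ) :
    laurentMonomial x (-β) = (laurentMonomial x β)⁻¹ := by
  simp [laurentMonomial, Finset.prod_inv_distrib]

lemma laurentMonomial_single [DecidableEq ι] (x : ι → F) (i : ι) (a : ℤ) :
    laurentMonomial x (Pi.single i a) = x i ^ a := by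
  rw [laurentMonomial, Finset.prod_eq_single i]
  · simp
  · intro j _ hj; simp [Pi.single_eq_of_ne hj]
  · simp

lemma laurentMonomial_congr {x y : ι → F} {β : ι → ℤ} (h : ∀ i, β i ≠ 0 → x i = y i) :
    laurentMonomial x β = laurentMonomial y β := by
  refine Finset.prod_congr rfl fun i _ => ?_
  by_cases hi : β i = 0
  · simp [hi]
  · rw [h i hi]

variable (K) in
/-- The evaluation of Laurent polynomials with exponents in `ι → ℤ` at nonzero elements. -/
noncomputable def laurentEval (x : ι → F) (hx : ∀ i, x i ≠ 0) :
    AddMonoidAlgebra K (ι → ℤ) →ₐ[K] F :=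
  AddMonoidAlgebra.lift K F (ι → ℤ)
    { toFun := fun β => laurentMonomial x β.toAdd
      map_one' := laurentMonomial_zero x
      map_mul' := fun β γ => laurentMonomial_add hx β.toAdd γ.toAdd }

lemma laurentEval_single {x : ι → F} (hx : ∀ i, x i ≠ 0) (β : ι → ℤ) (c : K) :
    laurentEval K x hx (AddMonoidAlgebra.single β c) = c • laurentMonomial x β := by
  simp [laurentEval]

/-- Laurent monomials in algebraically independent elements are linearly independent. -/
lemma laurentEval_injective {x : ι → F} (hx : ∀ i, x i ≠ 0) (hind : AlgebraicIndependent K x) :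
    Function.Injective (laurentEval K x hx) := by
  classical
  rw [injective_iff_map_eq_zero]
  intro f hf
  -- Clearing denominators by a monomial with exponent `δ` reduces to polynomials.
  obtain ⟨δ, hδ⟩ : ∃ δ : ι → ℤ, ∀ β ∈ f.coeff.support, ∀ i, 0 ≤ δ i + β i := by
    refine ⟨fun i => ∑ β ∈ f.coeff.support, |β i|, fun β hβ i => ?_⟩
    have h1 : |β i| ≤ ∑ β ∈ f.coeff.support, |β i| :=
      Finset.single_le_sum (f := fun β : ι → ℤ => |β i|) (fun _ _ => abs_nonneg _) hβ
    have := neg_abs_le (β i)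
    linarith
  let e : (ι → ℤ) → (ι →₀ ℕ) := fun β => Finsupp.equivFunOnFinite.symm fun i => (δ i + β i).toNat
  let p : MvPolynomial ι K := ∑ β ∈ f.coeff.support, MvPolynomial.monomial (e β) (f.coeff β)
  have hp : p = 0 := by
    have hinj := hind
    rw [AlgebraicIndependent, injective_iff_map_eq_zero] at hinj
    apply hinj
    have h2 : ∀ β ∈ f.coeff.support, MvPolynomial.aeval x (MvPolynomial.monomial (e β) (f.coeff β))
        = laurentMonomial x δ * (f.coeff β • laurentMonomial x β) := by
      intro β hβ
      rw [MvPolynomial.aeval_monomial, mul_smul_comm, ← laurentMonomial_add hx, Algebra.smul_def]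
      congr 1
      rw [Finsupp.prod_fintype _ _ (by simp)]
      refine Finset.prod_congr rfl fun i _ => ?_
      have := hδ β hβ i
      conv_rhs => rw [Pi.add_apply, ← Int.toNat_of_nonneg this, zpow_natCast]
      simp [e]
    rw [map_sum, Finset.sum_congr rfl h2, ← Finset.mul_sum]
    have h3 : ∑ β ∈ f.coeff.support, f.coeff β • laurentMonomial x β = 0 := by
      rw [← hf]
      conv_rhs => rw [laurentEval, AddMonoidAlgebra.lift_apply]
      rfl
    rw [h3, mul_zero]
  ext β
  by_contra hβ
  have hβ' : β ∈ f.coeff.support := Finsupp.mem_support_iff.2 hβ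
  apply hβ
  have h4 : p.coeff (e β) = 0 := by rw [hp]; simp
  rw [MvPolynomial.coeff_sum, Finset.sum_eq_single β] at h4
  · rwa [MvPolynomial.coeff_monomial, if_pos rfl] at h4
  · intro γ hγ hne
    rw [MvPolynomial.coeff_monomial, if_neg]
    intro heq
    apply hne
    ext i
    have h5 := DFunLike.congr_fun heq i
    have h6 := hδ β hβ' i
    have h7 := hδ γ hγ i
    simp only [e, Finsupp.equivFunOnFinite_symm_apply_apply] at h5
    omega
  · intro h; exact absurd hβ' h

lemma laurentMonomial_mem (x : ι → F) (β : ι → ℤ) :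
    laurentMonomial x β ∈ laurentSubalgebra K x :=
  prod_mem fun i _ =>
    zpow_mem_of_inv_mem (mem_laurentSubalgebra x i) (inv_mem_laurentSubalgebra x i) _

lemma range_laurentEval {x : ι → F} (hx : ∀ i, x i ≠ 0) :
    (laurentEval K x hx).range = laurentSubalgebra K x := by
  classical
  apply le_antisymm
  · rintro _ ⟨f, rfl⟩
    change laurentEval K x hx f ∈ _
    induction f using AddMonoidAlgebra.induction_linear with
    | zero => simp [zero_mem]
    | add f g hf hg => rw [map_add]; exact add_mem hf hg
    | single β c =>
      rw [laurentEval_single]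
      exact Subalgebra.smul_mem _ (laurentMonomial_mem x β) c
  · refine Algebra.adjoin_le ?_
    rintro _ (⟨i, rfl⟩ | ⟨i, rfl⟩)
    · refine ⟨AddMonoidAlgebra.single (Pi.single i 1) 1, ?_⟩
      change laurentEval K x hx _ = _
      rw [laurentEval_single, laurentMonomial_single]; simp
    · refine ⟨AddMonoidAlgebra.single (Pi.single i (-1)) 1, ?_⟩
      change laurentEval K x hx _ = _
      rw [laurentEval_single, laurentMonomial_single]; simp

end LaurentMonomials

/-! ### Gradings of Laurent polynomials -/

section Grading

variable {K G M : Type*} [Field K] [AddCommGroup G] [AddCommGroup M]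

open Classical in
/-- The component of degree `d` of a Laurent polynomial, for the grading of the group algebra of `G`
in which the monomial with exponent `β` has degree `v β`. -/
noncomputable def component (v : G →+ M) (d : M) :
    AddMonoidAlgebra K G →ₗ[K] AddMonoidAlgebra K G where
  toFun f := .ofCoeff (f.coeff.filter fun β => v β = d)
  map_add' f g := by simp [Finsupp.filter_add]
  map_smul' c f := by simp [Finsupp.filter_smul]

open Classical in
lemma component_single (v : G →+ M) (d : M) (β : G) (c : K) :
    component v d (AddMonoidAlgebra.single β c) =
      if v β = d then AddMonoidAlgebra.single β c else 0 := by
  change AddMonoidAlgebra.ofCoeff ((Finsupp.single β c).filter fun β => v β = d) = _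
  split_ifs with h
  · rw [Finsupp.filter_single_of_pos (fun β => v β = d) h]; rfl
  · rw [Finsupp.filter_single_of_neg (fun β => v β = d) h]; rfl

lemma component_single_mul (v : G →+ M) (d : M) (β : G) (c : K) (f : AddMonoidAlgebra K G) :
    component v d (AddMonoidAlgebra.single β c * f) =
      AddMonoidAlgebra.single β c * component v (d - v β) f := by
  induction f using AddMonoidAlgebra.induction_linear with
  | zero => simp
  | add f g hf hg => simp only [mul_add, map_add, hf, hg]
  | single γ a =>
    rw [AddMonoidAlgebra.single_mul_single, component_single, component_single, map_add]
    by_cases h : v β + v γ = d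
    · rw [if_pos h, if_pos (by rw [← h]; abel), AddMonoidAlgebra.single_mul_single]
    · rw [if_neg h, if_neg (by contrapose! h; rw [h]; abel), mul_zero]

lemma component_component {K G M : Type*} [Field K] [AddCommGroup G] [AddCommGroup M]
    (v : G →+ M) (d : M) (f : AddMonoidAlgebra K G) :
    component v d (component v d f) = component v d f := by
  classical
  induction f using AddMonoidAlgebra.induction_linear with
  | zero => simp
  | add f g hf hg => simp only [map_add, hf, hg]
  | single γ a =>
    by_cases h : v γ = d
    · rw [component_single, if_pos h, component_single, if_pos h]
    · rw [component_single, if_neg h, map_zero]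

lemma exists_finset_component (v : G →+ M) (f : AddMonoidAlgebra K G) :
    ∃ D : Finset M, (∀ d ∉ D, component v d f = 0) ∧ f = ∑ d ∈ D, component v d f := by
  classical
  refine ⟨f.coeff.support.image v, fun d hd => ?_, ?_⟩
  · ext β
    change (f.coeff.filter fun β => v β = d) β = 0
    rw [Finsupp.filter_apply]
    split_ifs with h
    · by_contra hβ
      exact hd (Finset.mem_image.2 ⟨β, Finsupp.mem_support_iff.2 hβ, h⟩)
    · rfl
  · ext β
    rw [AddMonoidAlgebra.coeff_sum, Finset.sum_apply']
    have h1 (d : M) : (component v d f).coeff β = if v β = d then f.coeff β else 0 := by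
      change (f.coeff.filter fun β => v β = d) β = _
      rw [Finsupp.filter_apply]
    simp only [h1, Finset.sum_ite_eq]
    split_ifs with h
    · rfl
    · by_contra hβ
      exact h (Finset.mem_image.2 ⟨β, Finsupp.mem_support_iff.2 hβ, rfl⟩)

/-- `p` is homogeneous of degree zero for the grading given by `v`, in the form in which this is
used: multiplication by `p` commutes with taking components. -/
def IsDegreeZero (v : G →+ M) (p : AddMonoidAlgebra K G) : Prop :=
  ∀ d f, component v d (p * f) = p * component v d f

lemma isDegreeZero_single {v : G →+ M} {β : G} (h : v β = 0) (c : K) :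
    IsDegreeZero v (AddMonoidAlgebra.single β c) := by
  intro d f
  rw [component_single_mul, h, sub_zero]

lemma isDegreeZero_one (v : G →+ M) : IsDegreeZero v (1 : AddMonoidAlgebra K G) := by
  intro d f; simp

lemma IsDegreeZero.add {v : G →+ M} {p p' : AddMonoidAlgebra K G} (h : IsDegreeZero v p)
    (h' : IsDegreeZero v p') : IsDegreeZero v (p + p') := by
  intro d f
  rw [add_mul, map_add, h, h', add_mul]

lemma IsDegreeZero.mul {v : G →+ M} {p p' : AddMonoidAlgebra K G} (h : IsDegreeZero v p)
    (h' : IsDegreeZero v p') : IsDegreeZero v (p * p') := by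
  intro d f
  rw [mul_assoc, h, h', mul_assoc]

lemma IsDegreeZero.pow {v : G →+ M} {p : AddMonoidAlgebra K G} (h : IsDegreeZero v p) (k : ℕ) :
    IsDegreeZero v (p ^ k) := by
  induction k with
  | zero => simpa using isDegreeZero_one v
  | succ k ih => rw [pow_succ]; exact ih.mul h

lemma IsDegreeZero.prod {v : G →+ M} {α : Type*} (s : Finset α) {p : α → AddMonoidAlgebra K G}
    (h : ∀ i ∈ s, IsDegreeZero v (p i)) : IsDegreeZero v (∏ i ∈ s, p i) := by
  classical
  induction s using Finset.induction_on with
  | empty => simpa using isDegreeZero_one v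
  | insert a s ha ih =>
    rw [Finset.prod_insert ha]
    exact (h a (by simp)).mul (ih fun i hi => h i (by simp [hi]))

/-- If `u` is a monomial of degree one and `p`, `c` have degree zero, then `u + c` is a nonzero
divisor modulo `p`: divisibility by `p` descends from the component of degree `d` to that of degree
`d - 1`. -/
lemma dvd_of_dvd_single_add_mul {v : G →+ ℤ} {p c g : AddMonoidAlgebra K G} {β : G}
    (hp : IsDegreeZero v p) (hc : IsDegreeZero v c) (hβ : v β = 1)
    (h : p ∣ (AddMonoidAlgebra.single β 1 + c) * g) : p ∣ g := by
  obtain ⟨f, hf⟩ := h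
  obtain ⟨D, hD, hsum⟩ := exists_finset_component v g
  have hstep (d : ℤ) (hd : p ∣ component v d g) : p ∣ component v (d - 1) g := by
    obtain ⟨e, he⟩ := hd
    have h1 := congrArg (component v d) hf
    rw [add_mul, map_add, component_single_mul, hc, hp, hβ, he] at h1
    have h2 : AddMonoidAlgebra.single (-β) (1 : K) * AddMonoidAlgebra.single β 1 = 1 := by
      rw [AddMonoidAlgebra.single_mul_single]; simp [AddMonoidAlgebra.one_def]
    refine ⟨AddMonoidAlgebra.single (-β) 1 * (component v d f - c * e), ?_⟩
    calc component v (d - 1) g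
        = AddMonoidAlgebra.single (-β) (1 : K) * AddMonoidAlgebra.single β 1 *
          component v (d - 1) g := by rw [h2, one_mul]
      _ = AddMonoidAlgebra.single (-β) (1 : K) * (AddMonoidAlgebra.single β 1 *
          component v (d - 1) g + c * (p * e) - p * (c * e)) := by ring
      _ = _ := by rw [h1]; ring
  obtain ⟨N, hN⟩ : ∃ N : ℤ, ∀ d ∈ D, d ≤ N := by
    obtain ⟨N, hN⟩ := D.bddAbove
    exact ⟨N, fun d hd => hN hd⟩
  have hall (k : ℕ) : p ∣ component v (N + 1 - k) g := by
    induction k with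
    | zero =>
      rw [hD]
      · exact dvd_zero p
      · intro h
        have := hN _ h
        simp only [Nat.cast_zero, sub_zero] at this
        omega
    | succ k ih =>
      have := hstep _ ih
      rwa [show N + 1 - (k : ℤ) - 1 = N + 1 - ((k + 1 : ℕ) : ℤ) by push_cast; ring] at this
  rw [hsum]
  refine Finset.dvd_sum fun d hd => ?_
  have := hall (N + 1 - d).toNat
  rwa [Int.toNat_of_nonneg (by have := hN d hd; omega), sub_sub_cancel] at this

end Grading

/-! ### Exchange polynomials and mutation of seeds -/

section ExchangeValue

variable {n m : ℕ}

/-- The value at `a` of the exchange polynomial in direction `k`. -/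
def exchangeValue {R : Type*} [CommSemiring R] (B : ExtMatrix n m) (k : Fin n)
    (a : Fin n ⊕ Fin m → R) : R :=
  ∏ i, a i ^ (B i k).toNat + ∏ i, a i ^ (-B i k).toNat

lemma exchangeValue_congr {R : Type*} [CommSemiring R] {B B' : ExtMatrix n m} {k : Fin n}
    {a a' : Fin n ⊕ Fin m → R} (hB : ∀ i, B i k = B' i k) (h : ∀ i, B i k ≠ 0 → a i = a' i) :
    exchangeValue B k a = exchangeValue B' k a' := by
  have key (i : Fin n ⊕ Fin m) : a i ^ (B i k).toNat = a' i ^ (B i k).toNat ∧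
      a i ^ (-B i k).toNat = a' i ^ (-B i k).toNat := by
    by_cases hi : B i k = 0
    · simp [hi]
    · simp [h i hi]
  rw [exchangeValue, Finset.prod_congr rfl fun i _ => (key i).1,
    Finset.prod_congr rfl fun i _ => (key i).2]
  simp only [hB, exchangeValue]

lemma exchangeValue_neg {R : Type*} [CommSemiring R] (B : ExtMatrix n m) (k : Fin n)
    (a : Fin n ⊕ Fin m → R) : exchangeValue (-B) k a = exchangeValue B k a := by
  simp [exchangeValue, add_comm]

lemma map_exchangeValue {R S T : Type*} [CommSemiring R] [CommSemiring S] [FunLike T R S]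
    [RingHomClass T R S] (f : T) (B : ExtMatrix n m) (k : Fin n) (a : Fin n ⊕ Fin m → R) :
    f (exchangeValue B k a) = exchangeValue B k (fun i => f (a i)) := by
  simp [exchangeValue, map_add, map_prod, map_pow]

lemma exchangeValue_mem {F S : Type*} [Field F] [SetLike S F] [SubsemiringClass S F] {L : S}
    {x : Fin n ⊕ Fin m → F} (h : ∀ i, x i ∈ L) (B : ExtMatrix n m) (k : Fin n) :
    exchangeValue B k x ∈ L :=
  add_mem (prod_mem fun i _ => pow_mem (h i) _) (prod_mem fun i _ => pow_mem (h i) _)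

/-- The exponent of the first monomial of the exchange polynomial in direction `k`. -/
def posExponent (B : ExtMatrix n m) (k : Fin n) : Fin n ⊕ Fin m → ℤ := fun i => max (B i k) 0

/-- The exponent of the second monomial of the exchange polynomial in direction `k`. -/
def negExponent (B : ExtMatrix n m) (k : Fin n) : Fin n ⊕ Fin m → ℤ := fun i => max (-B i k) 0

lemma posExponent_sub_negExponent (B : ExtMatrix n m) (k : Fin n) (i : Fin n ⊕ Fin m) :
    posExponent B k i - negExponent B k i = B i k := by
  simp only [posExponent, negExponent]
  rcases le_total (B i k) 0 with h | h <;> simp [h]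

lemma laurentMonomial_posExponent {F : Type*} [Field F] (B : ExtMatrix n m) (k : Fin n)
    (x : Fin n ⊕ Fin m → F) :
    laurentMonomial x (posExponent B k) = ∏ i, x i ^ (B i k).toNat :=
  Finset.prod_congr rfl fun i _ => by rw [posExponent, ← Int.ofNat_toNat, zpow_natCast]

lemma laurentMonomial_negExponent {F : Type*} [Field F] (B : ExtMatrix n m) (k : Fin n)
    (x : Fin n ⊕ Fin m → F) :
    laurentMonomial x (negExponent B k) = ∏ i, x i ^ (-B i k).toNat :=
  Finset.prod_congr rfl fun i _ => by rw [negExponent, ← Int.ofNat_toNat, zpow_natCast]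

lemma exchangeValue_eq_laurentMonomial {F : Type*} [Field F] (B : ExtMatrix n m) (k : Fin n)
    (x : Fin n ⊕ Fin m → F) :
    exchangeValue B k x =
      laurentMonomial x (posExponent B k) + laurentMonomial x (negExponent B k) := by
  rw [laurentMonomial_posExponent, laurentMonomial_negExponent, exchangeValue]

/-- The exchange polynomial in direction `k` as a Laurent polynomial. -/
noncomputable def exchangePoly (K : Type*) [Field K] (B : ExtMatrix n m) (k : Fin n) :
    AddMonoidAlgebra K (Fin n ⊕ Fin m → ℤ) :=
  AddMonoidAlgebra.single (posExponent B k) 1 + AddMonoidAlgebra.single (negExponent B k) 1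

lemma laurentEval_exchangePoly {K F : Type*} [Field K] [Field F] [Algebra K F]
    (B : ExtMatrix n m) (k : Fin n) {x : Fin n ⊕ Fin m → F} (hx : ∀ i, x i ≠ 0) :
    laurentEval K x hx (exchangePoly K B k) = exchangeValue B k x := by
  rw [exchangeValue_eq_laurentMonomial, exchangePoly, map_add, laurentEval_single,
    laurentEval_single, one_smul, one_smul]

lemma HasLeftInverse.exists_ne_zero {B : ExtMatrix n m} (h : HasLeftInverse B) (k : Fin n) :
    ∃ i, B i k ≠ 0 := by
  by_contra! hB
  obtain ⟨C, hC⟩ := h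
  have := congrFun (congrFun hC k) k
  simp [Matrix.mul_apply, hB] at this

end ExchangeValue

namespace SeedData

variable {K F : Type*} [Field K] [Field F] [Algebra K F] {n m : ℕ}

variable (K) in
/-- A seed whose matrix has full rank. Unlike the seed condition alone, this is preserved by
mutations in every characteristic: the exchange polynomials do not vanish. -/
structure IsFullRankSeed (s : SeedData F n m) : Prop where
  isSeed : s.IsSeed K
  hasLeftInverse : HasLeftInverse s.B

lemma IsFullRankSeed.ne_zero {s : SeedData F n m} (h : s.IsFullRankSeed K) (i) : s.x i ≠ 0 :=
  h.isSeed.algebraicIndependent.ne_zero i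

lemma IsFullRankSeed.laurentEval_injective {s : SeedData F n m} (h : s.IsFullRankSeed K) :
    Function.Injective (laurentEval K s.x h.ne_zero) :=
  ClusterAlg.laurentEval_injective h.ne_zero h.isSeed.algebraicIndependent

lemma IsFullRankSeed.exchangeValue_ne_zero {s : SeedData F n m} (h : s.IsFullRankSeed K)
    (k : Fin n) : exchangeValue s.B k s.x ≠ 0 := by
  rw [← laurentEval_exchangePoly (K := K) s.B k h.ne_zero, Ne,
    map_eq_zero_iff _ h.laurentEval_injective]
  intro h0
  have hne : negExponent s.B k ≠ posExponent s.B k := by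
    obtain ⟨i, hi⟩ := h.hasLeftInverse.exists_ne_zero k
    intro heq
    apply hi
    have := posExponent_sub_negExponent s.B k i
    rw [heq, sub_self] at this
    exact this.symm
  have := congrArg (fun f => f.coeff (posExponent s.B k)) h0
  simp [exchangePoly, hne] at this

lemma mutate_x_self (s : SeedData F n m) (k : Fin n) :
    (s.mutate k).x (Sum.inl k) = exchangeValue s.B k s.x / s.x (Sum.inl k) := by
  simp [mutate, exchangeValue]

lemma mutate_x_of_ne (s : SeedData F n m) {k : Fin n} {i : Fin n ⊕ Fin m} (h : i ≠ Sum.inl k) :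
    (s.mutate k).x i = s.x i := by
  simp [mutate, h]

lemma mutate_B (s : SeedData F n m) (k : Fin n) : (s.mutate k).B = mutateMatrix s.B k := rfl

lemma exchangeValue_mutate (s : SeedData F n m) (hB : IsExtendedExchange s.B) (k : Fin n) :
    exchangeValue (s.mutate k).B k (s.mutate k).x = exchangeValue s.B k s.x := by
  rw [← exchangeValue_neg s.B]
  refine exchangeValue_congr (fun i => mutateMatrix_apply_col _ _ _) fun i hi => ?_
  apply mutate_x_of_ne
  rintro rfl
  rw [mutate_B, mutateMatrix_apply_col, hB.diag] at hi
  simp at hi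

lemma IsFullRankSeed.mutate_mutate {s : SeedData F n m} (h : s.IsFullRankSeed K) (k : Fin n) :
    (s.mutate k).mutate k = s := by
  have hx : ((s.mutate k).mutate k).x = s.x := by
    ext i
    by_cases hi : i = Sum.inl k
    · subst hi
      rw [mutate_x_self, exchangeValue_mutate _ h.isSeed.exchange, mutate_x_self,
        div_div_cancel₀ (h.exchangeValue_ne_zero k)]
    · rw [mutate_x_of_ne _ hi, mutate_x_of_ne _ hi]
  have hB : ((s.mutate k).mutate k).B = s.B := mutateMatrix_mutateMatrix _ _
  generalize (s.mutate k).mutate k = u at hx hB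
  cases u
  cases s
  exact congrArg₂ SeedData.mk hx hB

/-- The elements of a mutated seed generate the same field, and their number is its transcendence
degree, so they are algebraically independent. -/
lemma IsFullRankSeed.mutate {s : SeedData F n m} (h : s.IsFullRankSeed K) (k : Fin n) :
    (s.mutate k).IsFullRankSeed K := by
  have hgen : IntermediateField.adjoin K (Set.range (s.mutate k).x) = ⊤ := by
    rw [← top_le_iff, ← h.isSeed.generates, IntermediateField.adjoin_le_iff]
    set L := IntermediateField.adjoin K (Set.range (s.mutate k).x)
    have hmem (i) : (s.mutate k).x i ∈ L :=
      IntermediateField.subset_adjoin K _ ⟨i, rfl⟩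
    rintro _ ⟨i, rfl⟩
    by_cases hi : i = Sum.inl k
    · subst hi
      rw [SetLike.mem_coe, ← h.mutate_mutate k, mutate_x_self]
      exact div_mem (exchangeValue_mem hmem _ _) (hmem _)
    · rw [← mutate_x_of_ne s hi]
      exact hmem i
  have halg : Algebra.IsAlgebraic (Algebra.adjoin K (Set.range (s.mutate k).x)) F := by
    refine ⟨fun z => ?_⟩
    have hz : z ∈ IntermediateField.adjoin K (Set.range (s.mutate k).x) := by rw [hgen]; trivial
    obtain ⟨r, hr, t, ht, rfl⟩ := IntermediateField.mem_adjoin_iff_div.1 hz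
    rw [div_eq_mul_inv]
    exact (isAlgebraic_algebraMap (⟨r, hr⟩ : Algebra.adjoin K (Set.range (s.mutate k).x))).mul
      (isAlgebraic_algebraMap (⟨t, ht⟩ : Algebra.adjoin K (Set.range (s.mutate k).x))).inv
  exact
    { isSeed :=
        { exchange := h.isSeed.exchange.mutate k
          algebraicIndependent :=
            (Algebra.IsAlgebraic.isTranscendenceBasis_of_lift_le_trdeg_of_finite K _
              h.isSeed.algebraicIndependent.lift_cardinalMk_le_trdeg).1
          generates := hgen }
      hasLeftInverse := h.hasLeftInverse.mutate h.isSeed.exchange k }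

lemma IsFullRankSeed.of_mutatesTo {s t : SeedData F n m} (h : s.IsFullRankSeed K)
    (hst : s.MutatesTo t) : t.IsFullRankSeed K := by
  induction hst with
  | refl => exact h
  | tail _ hk ih => obtain ⟨k, rfl⟩ := hk; exact ih.mutate k

lemma MutatesTo.x_inr {s t : SeedData F n m} (hst : s.MutatesTo t) (j : Fin m) :
    t.x (Sum.inr j) = s.x (Sum.inr j) := by
  induction hst with
  | refl => rfl
  | tail _ hk ih => obtain ⟨k, rfl⟩ := hk; rw [mutate_x_of_ne _ (by simp), ih]

lemma MutatesTo.symm {s t : SeedData F n m} (hst : s.MutatesTo t) (h : s.IsFullRankSeed K) :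
    t.MutatesTo s := by
  induction hst with
  | refl => exact Relation.ReflTransGen.refl
  | tail hu hk ih =>
    obtain ⟨k, rfl⟩ := hk
    exact Relation.ReflTransGen.head ⟨k, ((h.of_mutatesTo hu).mutate_mutate k).symm⟩ ih

end SeedData

/-! ### Denominators and regular elements -/

section Denominators

variable {K F : Type*} [Field K] [Field F] [Algebra K F]

/-- If multiplication by `w` takes a set of generators into the subalgebra `L`, then every element
of the algebra they generate is taken into `L` by a power of `w`. -/
lemma exists_pow_mul_mem {L : Subalgebra K F} {w : F} (hw : w ∈ L) {S : Set F}
    (hS : ∀ g ∈ S, w * g ∈ L) {z : F} (hz : z ∈ Algebra.adjoin K S) : ∃ N : ℕ, w ^ N * z ∈ L := by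
  induction hz using Algebra.adjoin_induction with
  | mem g hg => exact ⟨1, by simpa using hS g hg⟩
  | algebraMap c => exact ⟨0, by simp⟩
  | add a b _ _ iha ihb =>
    obtain ⟨N, hN⟩ := iha
    obtain ⟨N', hN'⟩ := ihb
    refine ⟨N + N', ?_⟩
    have : w ^ (N + N') * (a + b) = w ^ N' * (w ^ N * a) + w ^ N * (w ^ N' * b) := by ring
    rw [this]
    exact add_mem (mul_mem (pow_mem hw _) hN) (mul_mem (pow_mem hw _) hN')
  | mul a b _ _ iha ihb =>
    obtain ⟨N, hN⟩ := iha
    obtain ⟨N', hN'⟩ := ihb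
    refine ⟨N + N', ?_⟩
    have : w ^ (N + N') * (a * b) = (w ^ N * a) * (w ^ N' * b) := by ring
    rw [this]
    exact mul_mem hN hN'

/-- Multiplication by `w` is injective modulo `q` on the subalgebra `L`. -/
def IsRegularMod (L : Subalgebra K F) (q w : F) : Prop :=
  ∀ g ∈ L, ∀ h ∈ L, w * g = q * h → ∃ e ∈ L, g = q * e

lemma IsRegularMod.mul {L : Subalgebra K F} {q w w' : F} (hw' : w' ∈ L) (h : IsRegularMod L q w)
    (h' : IsRegularMod L q w') : IsRegularMod L q (w * w') := by
  intro g hg f hf heq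
  rw [mul_assoc] at heq
  obtain ⟨e, he, heq'⟩ := h _ (mul_mem hw' hg) f hf heq
  exact h' g hg e he heq'

lemma IsRegularMod.pow {L : Subalgebra K F} {q w : F} (hw : w ∈ L) (h : IsRegularMod L q w)
    (N : ℕ) : IsRegularMod L q (w ^ N) := by
  induction N with
  | zero =>
    intro g _ f hf heq
    exact ⟨f, hf, by simpa using heq⟩
  | succ N ih => rw [pow_succ]; exact ih.mul hw h

lemma IsRegularMod.pow_left {L : Subalgebra K F} {q w : F} (hq' : q ∈ L)
    (h : IsRegularMod L q w) (hq : q ≠ 0) (N : ℕ) : IsRegularMod L (q ^ N) w := by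
  induction N with
  | zero =>
    intro g hg f hf heq
    exact ⟨g, hg, by simp⟩
  | succ N ih =>
    intro g hg f hf heq
    rw [pow_succ', mul_assoc] at heq
    obtain ⟨e, he, rfl⟩ := h g hg _ (mul_mem (pow_mem hq' N) hf) heq
    have h2 : w * e = q ^ N * f := mul_left_cancel₀ hq (by rw [← heq]; ring)
    obtain ⟨e', he', rfl⟩ := ih e he f hf h2
    exact ⟨e', he', by ring⟩

/-- An element with two denominators, one of them regular modulo the other, has no denominator. -/
lemma IsRegularMod.mem_of_pow_mul_mem {L : Subalgebra K F} {q w z : F} (hw : w ∈ L) (hq' : q ∈ L)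
    (h : IsRegularMod L q w) (hq : q ≠ 0) {M N : ℕ} (hM : q ^ M * z ∈ L) (hN : w ^ N * z ∈ L) :
    z ∈ L := by
  have h1 := (h.pow hw N).pow_left hq' hq M
  obtain ⟨e, he, heq⟩ := h1 _ hM _ hN (by ring)
  rwa [mul_left_cancel₀ (pow_ne_zero M hq) heq]

variable {ι : Type*}

lemma exists_pow_mul_mem_laurentSubalgebra {x : ι → F} {L : Subalgebra K F} {w : F} (hw : w ∈ L)
    (h : ∀ i, w * x i ∈ L) (h' : ∀ i, w * (x i)⁻¹ ∈ L) {z : F}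
    (hz : z ∈ laurentSubalgebra K x) : ∃ N : ℕ, w ^ N * z ∈ L := by
  refine exists_pow_mul_mem hw ?_ hz
  rintro _ (⟨i, rfl⟩ | ⟨i, rfl⟩)
  · exact h i
  · exact h' i

lemma exists_pow_mul_mem_of_eq_div {x y : ι → F} {w : F} {k : ι} (hw : w ∈ laurentSubalgebra K y)
    (h0 : w ≠ 0) (h : ∀ i ≠ k, x i = y i) (hk : x k = w / y k) {z : F}
    (hz : z ∈ laurentSubalgebra K x) : ∃ N : ℕ, w ^ N * z ∈ laurentSubalgebra K y := by
  refine exists_pow_mul_mem_laurentSubalgebra hw (fun i => ?_) (fun i => ?_) hz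
  · by_cases hi : i = k
    · subst hi
      rw [hk, div_eq_mul_inv]
      exact mul_mem hw (mul_mem hw (inv_mem_laurentSubalgebra y i))
    · rw [h i hi]; exact mul_mem hw (mem_laurentSubalgebra y i)
  · by_cases hi : i = k
    · subst hi
      rw [hk, inv_div, mul_div_cancel₀ _ h0]
      exact mem_laurentSubalgebra y i
    · rw [h i hi]; exact mul_mem hw (inv_mem_laurentSubalgebra y i)

variable [Fintype ι]

/-- Regularity in the Laurent subalgebra can be checked on Laurent polynomials. -/
lemma isRegularMod_of_dvd {x : ι → F} (hx : ∀ i, x i ≠ 0)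
    (hinj : Function.Injective (laurentEval K x hx)) {p w : AddMonoidAlgebra K (ι → ℤ)}
    (h : ∀ g, p ∣ w * g → p ∣ g) :
    IsRegularMod (laurentSubalgebra K x) (laurentEval K x hx p) (laurentEval K x hx w) := by
  intro g hg f hf heq
  rw [← range_laurentEval hx] at hg hf
  obtain ⟨g, rfl⟩ := hg
  obtain ⟨f, rfl⟩ := hf
  change _ * laurentEval K x hx g = _ * laurentEval K x hx f at heq
  rw [← map_mul, ← map_mul] at heq
  obtain ⟨e, rfl⟩ := h g ⟨f, hinj heq⟩
  refine ⟨laurentEval K x hx e, ?_, map_mul _ _ _⟩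
  rw [← range_laurentEval hx]
  exact ⟨e, rfl⟩

end Denominators

section Coprimality

variable {K : Type*} [Field K] {n m : ℕ}

lemma single_mul_single_neg {G : Type*} [AddCommGroup G] (β : G) :
    AddMonoidAlgebra.single β (1 : K) * AddMonoidAlgebra.single (-β) 1 = 1 := by
  rw [AddMonoidAlgebra.single_mul_single]; simp [AddMonoidAlgebra.one_def]

/-- Each exchange polynomial is, up to a monomial, one plus the monomial of its column. -/
lemma exchangePoly_eq (B : ExtMatrix n m) (k : Fin n) :
    exchangePoly K B k = AddMonoidAlgebra.single (negExponent B k) 1 *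
      (AddMonoidAlgebra.single (fun i => B i k) 1 + 1) := by
  rw [exchangePoly, mul_add, AddMonoidAlgebra.single_mul_single, mul_one, mul_one]
  congr 2
  ext i
  have := posExponent_sub_negExponent B k i
  rw [Pi.add_apply]
  linarith

/-- The exchange polynomials of a full rank matrix are coprime: a row of a left inverse gives a
grading in which one of the two columns has degree one and the other degree zero. -/
lemma HasLeftInverse.exchangePoly_dvd {B : ExtMatrix n m} (h : HasLeftInverse B) {j k : Fin n}
    (hjk : j ≠ k) {g : AddMonoidAlgebra K (Fin n ⊕ Fin m → ℤ)}
    (hg : exchangePoly K B j ∣ exchangePoly K B k * g) : exchangePoly K B j ∣ g := by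
  obtain ⟨C, hC⟩ := h
  let v : (Fin n ⊕ Fin m → ℤ) →+ ℤ :=
    { toFun := fun β => ∑ i, C k i * β i
      map_zero' := by simp
      map_add' := fun β γ => by simp [mul_add, Finset.sum_add_distrib] }
  have hv (l : Fin n) : v (fun i => B i l) = if k = l then 1 else 0 := by
    have := congrFun (congrFun hC k) l
    rwa [Matrix.mul_apply, Matrix.one_apply] at this
  have hu (β : Fin n ⊕ Fin m → ℤ) : IsUnit (AddMonoidAlgebra.single β (1 : K)) :=
    IsUnit.of_mul_eq_one _ (single_mul_single_neg β)
  rw [exchangePoly_eq, (hu _).mul_left_dvd] at hg ⊢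
  rw [exchangePoly_eq, mul_assoc, (hu _).dvd_mul_left] at hg
  refine dvd_of_dvd_single_add_mul (v := v) ?_ (isDegreeZero_one v) ?_ hg
  · refine (isDegreeZero_single ?_ 1).add (isDegreeZero_one v)
    rw [hv, if_neg (Ne.symm hjk)]
  · rw [hv, if_pos rfl]

end Coprimality

namespace SeedData

variable {K F : Type*} [Field K] [Field F] [Algebra K F] {n m : ℕ}

lemma exchangeValue_mem_laurentSubalgebra (s : SeedData F n m) (k : Fin n) :
    exchangeValue s.B k s.x ∈ laurentSubalgebra K s.x :=
  ClusterAlg.exchangeValue_mem (mem_laurentSubalgebra s.x) _ _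

lemma IsFullRankSeed.isRegularMod {s : SeedData F n m} (h : s.IsFullRankSeed K) {j k : Fin n}
    (hjk : j ≠ k) : IsRegularMod (laurentSubalgebra K s.x) (exchangeValue s.B j s.x)
      (exchangeValue s.B k s.x) := by
  rw [← laurentEval_exchangePoly (K := K) s.B j h.ne_zero,
    ← laurentEval_exchangePoly (K := K) s.B k h.ne_zero]
  exact isRegularMod_of_dvd _ h.laurentEval_injective
    fun g => h.hasLeftInverse.exchangePoly_dvd hjk

lemma IsFullRankSeed.exists_pow_mul_mem_of_mem_mutate {s : SeedData F n m}
    (h : s.IsFullRankSeed K) (k : Fin n) {z : F} (hz : z ∈ laurentSubalgebra K (s.mutate k).x) :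
    ∃ N : ℕ, exchangeValue s.B k s.x ^ N * z ∈ laurentSubalgebra K s.x :=
  exists_pow_mul_mem_of_eq_div (k := Sum.inl k) (exchangeValue_mem_laurentSubalgebra _ k)
    (h.exchangeValue_ne_zero k) (fun _ hi => mutate_x_of_ne s hi) (mutate_x_self s k) hz

end SeedData

/-! ### The Laurent phenomenon in rank two -/

section RankTwo

variable {K F : Type*} [Field K] [Field F] [Algebra K F]

/-- The computation behind the Laurent phenomenon in rank two. Here `xj, xk` are the two variables
of a seed, `xj'` and `yk` their mutations, and `yj` the variable obtained by mutating at `k` and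
then at `j`; all other variables enter through the monomials `A, B, C, D, m`. In the Laurent ring
`L` of `yj, yk` and the rest, `xj'` and `xk` are elements that are regular modulo `xj`. -/
lemma isRegularMod_of_exchange {L : Subalgebra K F} {A B C D m xj xk xj' yj yk : F} {b : ℕ}
    (hb : b ≠ 0) (hA : A ∈ L) (hC : C ∈ L) (hD : D ∈ L) (hD' : D⁻¹ ∈ L)
    (hm : m ∈ L) (hm' : m⁻¹ ∈ L) (hyj : yj ∈ L) (hyj' : yj⁻¹ ∈ L) (hyk : yk ∈ L) (hyk' : yk⁻¹ ∈ L)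
    (hxj : xj ∈ L) (hD0 : D ≠ 0) (hm0 : m ≠ 0) (hxj0 : xj ≠ 0) (hyj0 : yj ≠ 0) (hyk0 : yk ≠ 0)
    (h1 : xk * yk = D + C * xj ^ b) (h2 : xj' * xj = xk ^ b * A + B)
    (h3 : yj * xj = m * (D ^ b * A + yk ^ b * B))
    (hreg : IsRegularMod L (yj * xj) (m⁻¹ * yj + A * C)) :
    xk ∈ L ∧ xj' ∈ L ∧ IsRegularMod L (yj * xj) (xj' * xk) := by
  obtain ⟨b, rfl⟩ := Nat.exists_eq_add_one_of_ne_zero hb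
  obtain ⟨T, hT, hTeq⟩ : ∃ T ∈ L, (D + C * xj ^ (b + 1)) ^ (b + 1) - D ^ (b + 1) =
      (C * xj ^ (b + 1)) * T := by
    obtain ⟨T, hT⟩ := sub_dvd_pow_sub_pow (⟨D + C * xj ^ (b + 1),
      add_mem hD (mul_mem hC (pow_mem hxj _))⟩ : L) ⟨D, hD⟩ (b + 1)
    refine ⟨T, T.2, ?_⟩
    have := congrArg (Subtype.val) hT
    simpa using this
  have hxk : xk ∈ L := by
    have : xk = yk⁻¹ * (D + C * xj ^ (b + 1)) := by
      rw [← h1]; field_simp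
    rw [this]
    exact mul_mem hyk' (add_mem hD (mul_mem hC (pow_mem hxj _)))
  -- The exchange relations express `xj'` through the variables of `L`.
  have key : yk ^ (b + 1) * xj' = m⁻¹ * yj + xj ^ b * (A * C * T) := by
    apply mul_right_cancel₀ hxj0
    have e1 : m⁻¹ * yj * xj = D ^ (b + 1) * A + yk ^ (b + 1) * B := by
      rw [mul_assoc, h3, inv_mul_cancel_left₀ hm0]
    calc yk ^ (b + 1) * xj' * xj = yk ^ (b + 1) * (xj' * xj) := by ring
      _ = (xk * yk) ^ (b + 1) * A + yk ^ (b + 1) * B := by rw [h2]; ring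
      _ = ((D + C * xj ^ (b + 1)) ^ (b + 1) - D ^ (b + 1)) * A +
          (D ^ (b + 1) * A + yk ^ (b + 1) * B) := by rw [h1]; ring
      _ = (m⁻¹ * yj + xj ^ b * (A * C * T)) * xj := by rw [hTeq, ← e1]; ring
  have hxj' : xj' ∈ L := by
    have : xj' = yk⁻¹ ^ (b + 1) * (m⁻¹ * yj + xj ^ b * (A * C * T)) := by
      rw [← key, ← mul_assoc, ← mul_pow, inv_mul_cancel₀ hyk0, one_pow, one_mul]
    rw [this]
    exact mul_mem (pow_mem hyk' _) (add_mem (mul_mem hm' hyj)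
      (mul_mem (pow_mem hxj _) (mul_mem (mul_mem hA hC) hT)))
  refine ⟨hxk, hxj', IsRegularMod.mul hxk ?_ ?_⟩
  -- Modulo `xj` the second summand of `key` vanishes, and `xj'` is a unit, unless the exponent is
  -- one. In that case `A * C * T = A * C`, and the hypothesis `hreg` applies.
  · intro g hg h hh heq
    rcases Nat.eq_zero_or_pos b with rfl | hbpos
    · have hT1 : C * xj * (A * T) = C * xj * A := by
        have : C * xj * T = C * xj := by simpa using hTeq.symm
        calc C * xj * (A * T) = (C * xj * T) * A := by ring
          _ = _ := by rw [this]
      have hT2 : A * C * T = A * C := mul_right_cancel₀ hxj0 (by linear_combination hT1)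
      refine hreg g hg (yk * h) (mul_mem hyk hh) ?_
      have key' : yk * xj' = m⁻¹ * yj + A * C := by rw [← hT2]; simpa using key
      rw [← key']
      linear_combination yk * heq
    · obtain ⟨c, rfl⟩ := Nat.exists_eq_add_one_of_ne_zero hbpos.ne'
      refine ⟨m * yj⁻¹ * yj⁻¹ * (yj * (yk ^ (c + 1 + 1) * h) - xj ^ c * (A * C * T) * g),
        mul_mem (mul_mem (mul_mem hm hyj') hyj') (sub_mem (mul_mem hyj (mul_mem (pow_mem hyk _) hh))
          (mul_mem (mul_mem (pow_mem hxj _) (mul_mem (mul_mem hA hC) hT)) hg)), ?_⟩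
      have e : m⁻¹ * yj * g = xj * (yj * (yk ^ (c + 1 + 1) * h) - xj ^ c * (A * C * T) * g) := by
        linear_combination (-g) * key + yk ^ (c + 1 + 1) * heq
      calc g = (m * m⁻¹) * (yj⁻¹ * yj) * g := by
            rw [mul_inv_cancel₀ hm0, inv_mul_cancel₀ hyj0, one_mul, one_mul]
        _ = m * yj⁻¹ * (m⁻¹ * yj * g) := by ring
        _ = yj * yj⁻¹ * (m * yj⁻¹ * (m⁻¹ * yj * g)) := by rw [mul_inv_cancel₀ hyj0, one_mul]
        _ = _ := by rw [e]; ring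
  · intro g hg h hh heq
    refine ⟨D⁻¹ * (yk * h - C * xj ^ b * yj⁻¹ * g), mul_mem hD' (sub_mem (mul_mem hyk hh)
      (mul_mem (mul_mem (mul_mem hC (pow_mem hxj _)) hyj') hg)), ?_⟩
    have e : D * g = yj * xj * (yk * h - C * xj ^ b * yj⁻¹ * g) := by
      have : yj * xj * (yk * h - C * xj ^ b * yj⁻¹ * g) =
        yk * (yj * xj * h) - (yj * yj⁻¹) * (C * xj ^ (b + 1) * g) := by ring
      rw [this, ← heq, mul_inv_cancel₀ hyj0]
      linear_combination (-g) * h1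
    calc g = D⁻¹ * (D * g) := by rw [inv_mul_cancel_left₀ hD0]
      _ = _ := by rw [e]; ring

end RankTwo

namespace SeedData

variable {K F : Type*} [Field K] [Field F] [Algebra K F] {n m : ℕ}

lemma mutate_mutate_x_of_ne (s : SeedData F n m) {j k : Fin n} {i : Fin n ⊕ Fin m}
    (hj : i ≠ Sum.inl j) (hk : i ≠ Sum.inl k) : ((s.mutate k).mutate j).x i = s.x i := by
  rw [mutate_x_of_ne _ hj, mutate_x_of_ne _ hk]

/-- If `j` and `k` are not joined in the quiver, the two mutations do not interact and the claim
follows from the coprimality of the exchange polynomials. -/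
lemma IsFullRankSeed.mem_mutate_mutate_of_eq_zero {s : SeedData F n m} (h : s.IsFullRankSeed K)
    {j k : Fin n} (hjk : j ≠ k) (hb : s.B (Sum.inl k) j = 0) {z : F}
    (hk : z ∈ laurentSubalgebra K (s.mutate k).x) (hj : z ∈ laurentSubalgebra K (s.mutate j).x) :
    z ∈ laurentSubalgebra K ((s.mutate k).mutate j).x := by
  have hb' : s.B (Sum.inl j) k = 0 := by rw [h.isSeed.exchange, hb, neg_zero]
  have hne : (Sum.inl j : Fin n ⊕ Fin m) ≠ Sum.inl k := by simpa using hjk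
  have h1 := h.mutate k
  have h2 := h1.mutate j
  have hcolj (i) : (s.mutate k).B i j = s.B i j := by
    rw [mutate_B, mutateMatrix]
    by_cases hi : i = Sum.inl k
    · simp [hi, hb]
    · simp [hi, hjk, hb]
  have hcolk (i) : ((s.mutate k).mutate j).B i k = - s.B i k := by
    rw [mutate_B, mutateMatrix, mutate_B, mutateMatrix_apply_col]
    by_cases hi : i = Sum.inl j
    · simp [hi, hb']
    · simp [hi, hjk.symm, mutateMatrix_apply_col, hb']
  have hPk : exchangeValue ((s.mutate k).mutate j).B k ((s.mutate k).mutate j).x =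
      exchangeValue s.B k s.x := by
    rw [← exchangeValue_neg s.B]
    refine exchangeValue_congr hcolk fun i hi => mutate_mutate_x_of_ne s ?_ ?_
    · rintro rfl; simp [hcolk, hb'] at hi
    · rintro rfl; simp [hcolk, h.isSeed.exchange.diag] at hi
  have hPj : exchangeValue (s.mutate k).B j (s.mutate k).x = exchangeValue s.B j s.x := by
    refine exchangeValue_congr hcolj fun i hi => mutate_x_of_ne s ?_
    rintro rfl
    rw [hcolj] at hi
    exact hi hb
  obtain ⟨M, hM⟩ := h2.exists_pow_mul_mem_of_mem_mutate j (by rwa [h1.mutate_mutate])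
  obtain ⟨N, hN⟩ : ∃ N : ℕ, exchangeValue ((s.mutate k).mutate j).B k
      ((s.mutate k).mutate j).x ^ N * z ∈ laurentSubalgebra K ((s.mutate k).mutate j).x := by
    refine exists_pow_mul_mem_of_eq_div (k := Sum.inl k) (exchangeValue_mem_laurentSubalgebra _ k)
      (h2.exchangeValue_ne_zero k) (fun i hi => ?_) ?_ hj
    · by_cases hij : i = Sum.inl j
      · subst hij
        rw [mutate_x_self, mutate_x_self, hPj, mutate_x_of_ne _ hne]
      · rw [mutate_x_of_ne _ hij, mutate_mutate_x_of_ne _ hij hi]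
    · rw [hPk, mutate_x_of_ne _ hne.symm, mutate_x_of_ne _ hne.symm, mutate_x_self,
        div_div_cancel₀ (h.exchangeValue_ne_zero k)]
  exact (h2.isRegularMod hjk).mem_of_pow_mul_mem (exchangeValue_mem_laurentSubalgebra _ k)
    (exchangeValue_mem_laurentSubalgebra _ j)
    (h2.exchangeValue_ne_zero j) hM hN

/-- If there are `b > 0` arrows from `k` to `j`, the claim follows from the exchange relations at
`k`, at `j`, and at `j` after the mutation at `k`. -/
lemma IsFullRankSeed.mem_mutate_mutate_of_pos {s : SeedData F n m} (h : s.IsFullRankSeed K)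
    {j k : Fin n} (hjk : j ≠ k) (hb : 0 < s.B (Sum.inl k) j) {z : F}
    (hk : z ∈ laurentSubalgebra K (s.mutate k).x) (hj : z ∈ laurentSubalgebra K (s.mutate j).x) :
    z ∈ laurentSubalgebra K ((s.mutate k).mutate j).x := by
  have hb' : s.B (Sum.inl j) k = - s.B (Sum.inl k) j := h.isSeed.exchange _ _
  obtain ⟨b, hbeq⟩ : ∃ b : ℕ, s.B (Sum.inl k) j = b := ⟨_, (Int.toNat_of_nonneg hb.le).symm⟩
  rw [hbeq] at hb hb'
  have hb0 : b ≠ 0 := by rintro rfl; simp at hb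
  have hne : (Sum.inl j : Fin n ⊕ Fin m) ≠ Sum.inl k := by simpa using hjk
  have h1 := h.mutate k
  have h2 := h1.mutate j
  have hkk := h.isSeed.exchange.diag k
  have hjj := h.isSeed.exchange.diag j
  have hx := h.ne_zero
  have hx1 := h1.ne_zero
  have hx2 := h2.ne_zero
  set s1 := s.mutate k with hs1
  set s2 := s1.mutate j with hs2
  set L := laurentSubalgebra K s2.x with hL
  -- The column of `j` after the mutation at `k`.
  have hcol (i) (hi : i ≠ Sum.inl k) : s1.B i j = s.B i j + max (s.B i k) 0 * b := by
    rw [hs1, mutate_B, mutateMatrix]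
    simp [hi, hjk, hbeq]
  have hcolk : s1.B (Sum.inl k) j = -b := by rw [hs1, mutate_B, mutateMatrix_apply_row, hbeq]
  -- The exponents of the monomials in the variables other than those at `j` and `k`.
  set δD := posExponent s.B k with hδD
  set δC := negExponent s.B k - Pi.single (Sum.inl j) (b : ℤ) with hδC
  set δA := posExponent s.B j - Pi.single (Sum.inl k) (b : ℤ) with hδA
  set δB := negExponent s.B j with hδB
  set δm := negExponent s1.B j - Pi.single (Sum.inl k) (b : ℤ) - δB with hδm
  have hDj : δD (Sum.inl j) = 0 := by simp [hδD, posExponent, hb']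
  have hDk : δD (Sum.inl k) = 0 := by simp [hδD, posExponent, hkk]
  have hCj : δC (Sum.inl j) = 0 := by simp [hδC, negExponent, hb']
  have hCk : δC (Sum.inl k) = 0 := by simp [hδC, negExponent, hkk, hjk.symm]
  have hAj : δA (Sum.inl j) = 0 := by simp [hδA, posExponent, hjj, hjk]
  have hAk : δA (Sum.inl k) = 0 := by simp [hδA, posExponent, hbeq]
  have hBj : δB (Sum.inl j) = 0 := by simp [hδB, negExponent, hjj]
  have hBk : δB (Sum.inl k) = 0 := by simp [hδB, negExponent, hbeq]
  have hs1jj : s1.B (Sum.inl j) j = 0 := h1.isSeed.exchange.diag j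
  have hmj : δm (Sum.inl j) = 0 := by simp [hδm, negExponent, hBj, hs1jj, hjk]
  have hmk : δm (Sum.inl k) = 0 := by simp [hδm, negExponent, hBk, hcolk]
  have hrest1 (β : Fin n ⊕ Fin m → ℤ) (hβk : β (Sum.inl k) = 0) :
      laurentMonomial s1.x β = laurentMonomial s.x β :=
    laurentMonomial_congr fun i hi => mutate_x_of_ne s (by rintro rfl; exact hi hβk)
  have hrest (β : Fin n ⊕ Fin m → ℤ) (hβj : β (Sum.inl j) = 0) (hβk : β (Sum.inl k) = 0) :
      laurentMonomial s2.x β = laurentMonomial s.x β := by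
    rw [← hrest1 β hβk]
    exact laurentMonomial_congr fun i hi => mutate_x_of_ne s1 (by rintro rfl; exact hi hβj)
  have hmem (β : Fin n ⊕ Fin m → ℤ) (hβj : β (Sum.inl j) = 0) (hβk : β (Sum.inl k) = 0) :
      laurentMonomial s.x β ∈ L := by
    rw [← hrest β hβj hβk]; exact laurentMonomial_mem _ _
  have hmem' (β : Fin n ⊕ Fin m → ℤ) (hβj : β (Sum.inl j) = 0) (hβk : β (Sum.inl k) = 0) :
      (laurentMonomial s.x β)⁻¹ ∈ L := by
    rw [← laurentMonomial_neg]; exact hmem _ (by simp [hβj]) (by simp [hβk])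
  have hyk : s2.x (Sum.inl k) = s1.x (Sum.inl k) := mutate_x_of_ne s1 hne.symm
  have hx1j : s1.x (Sum.inl j) = s.x (Sum.inl j) := mutate_x_of_ne s hne
  -- The three exchange relations.
  have e1 : s.x (Sum.inl k) * s2.x (Sum.inl k) =
      laurentMonomial s.x δD + laurentMonomial s.x δC * s.x (Sum.inl j) ^ b := by
    rw [hyk, hs1, mutate_x_self, mul_div_cancel₀ _ (hx _), exchangeValue_eq_laurentMonomial,
      show negExponent s.B k = δC + Pi.single (Sum.inl j) (b : ℤ) by rw [hδC, sub_add_cancel],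
      laurentMonomial_add hx, laurentMonomial_single, zpow_natCast]
  have e2 : (s.mutate j).x (Sum.inl j) * s.x (Sum.inl j) =
      s.x (Sum.inl k) ^ b * laurentMonomial s.x δA + laurentMonomial s.x δB := by
    rw [mutate_x_self, div_mul_cancel₀ _ (hx _), exchangeValue_eq_laurentMonomial,
      show posExponent s.B j = Pi.single (Sum.inl k) (b : ℤ) + δA by rw [hδA]; abel,
      laurentMonomial_add hx, laurentMonomial_single, zpow_natCast]
  have e3' : s2.x (Sum.inl j) * s.x (Sum.inl j) = exchangeValue s1.B j s1.x := by
    rw [hs2, mutate_x_self, ← hx1j, div_mul_cancel₀ _ (hx1 _)]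
  -- Both monomials of the third relation, up to the common factor with exponent `δm`.
  have hpos : posExponent s1.B j = δm + (b • δD + δA) := by
    ext i
    by_cases hi : i = Sum.inl k
    · subst hi
      simp [hmk, hDk, hAk, posExponent, hcolk]
    · have g1 := posExponent_sub_negExponent s1.B j i
      have g2 := posExponent_sub_negExponent s.B j i
      rw [hcol i hi] at g1
      have g3 : (b • δD) i = max (s.B i k) 0 * b := by simp [hδD, posExponent, mul_comm]
      simp only [hδm, hδA, hδB, Pi.add_apply, Pi.sub_apply, Pi.single_eq_of_ne hi, g3]
      linarith
  have hneg : negExponent s1.B j = δm + δB + Pi.single (Sum.inl k) (b : ℤ) := by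
    rw [hδm]; abel
  have hmonb (N : ℕ) : laurentMonomial s.x (N • δD) = laurentMonomial s.x δD ^ N := by
    induction N with
    | zero => simp [laurentMonomial_zero]
    | succ N ih => rw [succ_nsmul, laurentMonomial_add hx, ih, pow_succ]
  have e3 : s2.x (Sum.inl j) * s.x (Sum.inl j) = laurentMonomial s.x δm *
      (laurentMonomial s.x δD ^ b * laurentMonomial s.x δA +
        s2.x (Sum.inl k) ^ b * laurentMonomial s.x δB) := by
    rw [e3', exchangeValue_eq_laurentMonomial, hrest1 (posExponent s1.B j)
      (by simp [posExponent, hcolk]), hneg, laurentMonomial_add hx1 (δm + δB),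
      hrest1 (δm + δB) (by simp [hmk, hBk]), laurentMonomial_single, zpow_natCast, hpos,
      laurentMonomial_add hx, laurentMonomial_add hx, laurentMonomial_add hx, hmonb, hyk]
    ring
  have hq : s2.x (Sum.inl j) * s.x (Sum.inl j) = exchangeValue s2.B j s2.x := by
    rw [e3', hs2, exchangeValue_mutate _ h1.isSeed.exchange]
  have hxjL : s.x (Sum.inl j) ∈ L := by
    have : s.x (Sum.inl j) = (s2.x (Sum.inl j))⁻¹ * exchangeValue s2.B j s2.x := by
      rw [← hq, inv_mul_cancel_left₀ (hx2 _)]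
    rw [this]
    exact mul_mem (inv_mem_laurentSubalgebra _ _) (exchangeValue_mem_laurentSubalgebra _ j)
  -- In the grading by the exponent at `j` the modulus is homogeneous, and the element is the sum
  -- of a monomial of degree one and a monomial of degree zero.
  have hreg : IsRegularMod L (s2.x (Sum.inl j) * s.x (Sum.inl j)) ((laurentMonomial s.x δm)⁻¹ *
      s2.x (Sum.inl j) + laurentMonomial s.x δA * laurentMonomial s.x δC) := by
    have hw : (laurentMonomial s.x δm)⁻¹ * s2.x (Sum.inl j) +
        laurentMonomial s.x δA * laurentMonomial s.x δC = laurentEval K s2.x hx2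
          (AddMonoidAlgebra.single (-δm + Pi.single (Sum.inl j) 1) 1 +
            AddMonoidAlgebra.single (δA + δC) 1) := by
      rw [map_add, laurentEval_single, laurentEval_single, one_smul, one_smul,
        laurentMonomial_add hx2, laurentMonomial_neg, hrest _ hmj hmk, laurentMonomial_single,
        zpow_one, laurentMonomial_add hx2, hrest _ hAj hAk, hrest _ hCj hCk]
    rw [hq, hw, ← laurentEval_exchangePoly (K := K) s2.B j hx2]
    have hs2jj : s2.B (Sum.inl j) j = 0 := h2.isSeed.exchange.diag j
    refine isRegularMod_of_dvd hx2 h2.laurentEval_injective fun g hg =>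
      dvd_of_dvd_single_add_mul (v := Pi.evalAddMonoidHom _ (Sum.inl j)) ?_ ?_ ?_ hg
    · exact (isDegreeZero_single (by simp [posExponent, hs2jj]) 1).add
        (isDegreeZero_single (by simp [negExponent, hs2jj]) 1)
    · exact isDegreeZero_single (by simp [hAj, hCj]) 1
    · simp [hmj]
  obtain ⟨hxk, hxj', hr⟩ := isRegularMod_of_exchange hb0 (hmem _ hAj hAk) (hmem _ hCj hCk)
    (hmem _ hDj hDk) (hmem' _ hDj hDk) (hmem _ hmj hmk) (hmem' _ hmj hmk)
    (mem_laurentSubalgebra s2.x _) (inv_mem_laurentSubalgebra s2.x _)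
    (mem_laurentSubalgebra s2.x _) (inv_mem_laurentSubalgebra s2.x _) hxjL
    (laurentMonomial_ne_zero hx _) (laurentMonomial_ne_zero hx _) (hx _) (hx2 _) (hx2 _) e1 e2 e3
    hreg
  rw [hq] at hr
  obtain ⟨M, hM⟩ := h2.exists_pow_mul_mem_of_mem_mutate j (z := z) (by rwa [hs2, h1.mutate_mutate])
  have hx3 := (h.mutate j).ne_zero
  have hx3k : (s.mutate j).x (Sum.inl k) = s.x (Sum.inl k) := mutate_x_of_ne s hne.symm
  obtain ⟨N, hN⟩ : ∃ N : ℕ, ((s.mutate j).x (Sum.inl j) * s.x (Sum.inl k)) ^ N * z ∈ L := by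
    refine exists_pow_mul_mem_laurentSubalgebra (mul_mem hxj' hxk) (fun i => ?_) (fun i => ?_) hj
    · refine mul_mem (mul_mem hxj' hxk) ?_
      by_cases hij : i = Sum.inl j
      · subst hij; exact hxj'
      · by_cases hik : i = Sum.inl k
        · subst hik; rwa [hx3k]
        · rw [mutate_x_of_ne _ hij, ← mutate_mutate_x_of_ne s hij hik]
          exact mem_laurentSubalgebra _ _
    · by_cases hij : i = Sum.inl j
      · subst hij
        rwa [mul_right_comm, mul_inv_cancel₀ (hx3 _), one_mul]
      · by_cases hik : i = Sum.inl k
        · subst hik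
          rwa [hx3k, mul_assoc, mul_inv_cancel₀ (hx _), mul_one]
        · refine mul_mem (mul_mem hxj' hxk) ?_
          rw [mutate_x_of_ne _ hij, ← mutate_mutate_x_of_ne s hij hik]
          exact inv_mem_laurentSubalgebra _ _
  exact hr.mem_of_pow_mul_mem (mul_mem hxj' hxk) (exchangeValue_mem_laurentSubalgebra _ j)
    (h2.exchangeValue_ne_zero j) hM hN

/-- The seed with the opposite matrix. -/
def neg (s : SeedData F n m) : SeedData F n m := ⟨s.x, -s.B⟩

lemma neg_mutate (s : SeedData F n m) (k : Fin n) : s.neg.mutate k = (s.mutate k).neg := by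
  have hx : (s.neg.mutate k).x = (s.mutate k).neg.x := by
    ext i
    by_cases hi : i = Sum.inl k
    · subst hi
      change _ = (s.mutate k).x _
      rw [mutate_x_self, mutate_x_self]
      exact congrArg (· / _) (exchangeValue_neg s.B k s.x)
    · change _ = (s.mutate k).x _
      rw [mutate_x_of_ne _ hi, mutate_x_of_ne _ hi]
      rfl
  exact congrArg₂ SeedData.mk hx (mutateMatrix_neg s.B k)

lemma IsFullRankSeed.neg {s : SeedData F n m} (h : s.IsFullRankSeed K) : s.neg.IsFullRankSeed K :=
  { isSeed :=
      { exchange := fun i j => by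
          have := h.isSeed.exchange i j
          change - s.B _ _ = - - s.B _ _
          rw [this]
        algebraicIndependent := h.isSeed.algebraicIndependent
        generates := h.isSeed.generates }
    hasLeftInverse := h.hasLeftInverse.neg }

/-- The Laurent phenomenon in rank two. -/
lemma IsFullRankSeed.mem_mutate_mutate {s : SeedData F n m} (h : s.IsFullRankSeed K)
    {j k : Fin n} (hjk : j ≠ k) {z : F}
    (hk : z ∈ laurentSubalgebra K (s.mutate k).x) (hj : z ∈ laurentSubalgebra K (s.mutate j).x) :
    z ∈ laurentSubalgebra K ((s.mutate k).mutate j).x := by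
  rcases lt_trichotomy (s.B (Sum.inl k) j) 0 with hb | hb | hb
  · have := h.neg.mem_mutate_mutate_of_pos hjk (z := z) (by change 0 < - s.B _ _; omega)
      (by rwa [neg_mutate]) (by rwa [neg_mutate])
    rwa [neg_mutate, neg_mutate] at this
  · exact h.mem_mutate_mutate_of_eq_zero hjk hb hk hj
  · exact h.mem_mutate_mutate_of_pos hjk hb hk hj

variable (K) in
/-- The upper bound of a seed: the elements that are Laurent polynomials in the variables of the
seed and in those of each of its mutations. -/
def upperBound (s : SeedData F n m) : Subalgebra K F :=
  laurentSubalgebra K s.x ⊓ ⨅ k, laurentSubalgebra K (s.mutate k).x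

lemma mem_upperBound {s : SeedData F n m} {z : F} : z ∈ s.upperBound K ↔
    z ∈ laurentSubalgebra K s.x ∧ ∀ k, z ∈ laurentSubalgebra K (s.mutate k).x := by
  simp [upperBound, Algebra.mem_inf, Algebra.mem_iInf]

lemma IsFullRankSeed.upperBound_le_mutate {s : SeedData F n m} (h : s.IsFullRankSeed K)
    (k : Fin n) : s.upperBound K ≤ (s.mutate k).upperBound K := by
  intro z hz
  rw [mem_upperBound] at hz ⊢
  refine ⟨hz.2 k, fun j => ?_⟩
  by_cases hjk : j = k
  · subst hjk
    rw [h.mutate_mutate]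
    exact hz.1
  · exact h.mem_mutate_mutate hjk (hz.2 k) (hz.2 j)

lemma IsFullRankSeed.upperBound_le_of_mutatesTo {s t : SeedData F n m} (h : s.IsFullRankSeed K)
    (hst : s.MutatesTo t) : s.upperBound K ≤ t.upperBound K := by
  induction hst with
  | refl => exact le_rfl
  | tail hu hk ih =>
    obtain ⟨k, rfl⟩ := hk
    exact ih.trans ((h.of_mutatesTo hu).upperBound_le_mutate k)

lemma IsFullRankSeed.x_mem_upperBound {s : SeedData F n m} (h : s.IsFullRankSeed K)
    (i : Fin n ⊕ Fin m) : s.x i ∈ s.upperBound K := by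
  rw [mem_upperBound]
  refine ⟨mem_laurentSubalgebra _ _, fun k => ?_⟩
  by_cases hi : i = Sum.inl k
  · subst hi
    have e := mutate_x_self (s.mutate k) k
    rw [h.mutate_mutate] at e
    rw [e, div_eq_mul_inv]
    exact mul_mem (exchangeValue_mem_laurentSubalgebra _ k) (inv_mem_laurentSubalgebra _ _)
  · rw [← mutate_x_of_ne s hi]
    exact mem_laurentSubalgebra _ _

lemma inv_x_inr_mem_upperBound (s : SeedData F n m) (j : Fin m) :
    (s.x (Sum.inr j))⁻¹ ∈ s.upperBound K := by
  rw [mem_upperBound]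
  refine ⟨inv_mem_laurentSubalgebra _ _, fun k => ?_⟩
  rw [← mutate_x_of_ne s (k := k) (by simp)]
  exact inv_mem_laurentSubalgebra _ _

/-- The cluster algebra is contained in the upper bound of each of its seeds. -/
lemma IsFullRankSeed.clusterAlgebra_le_upperBound {s t : SeedData F n m}
    (h : s.IsFullRankSeed K) (hst : s.MutatesTo t) : s.clusterAlgebra K ≤ t.upperBound K := by
  refine le_trans (Algebra.adjoin_le ?_) (h.upperBound_le_of_mutatesTo hst)
  rintro z (⟨u, hu, i, rfl⟩ | ⟨j, rfl⟩)
  · exact (h.of_mutatesTo hu).upperBound_le_of_mutatesTo (hu.symm h)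
      ((h.of_mutatesTo hu).x_mem_upperBound i)
  · exact inv_x_inr_mem_upperBound _ j

end SeedData

/-! ### The upper bound at an independent set of vertices -/

section Divisibility

variable {R : Type*} [CommRing R] [IsDomain R]

lemma pow_dvd_of_dvd_mul {p w : R} (hp : p ≠ 0) (h : ∀ g, p ∣ w * g → p ∣ g) (e : ℕ) {g : R}
    (hg : p ^ e ∣ w * g) : p ^ e ∣ g := by
  induction e generalizing g with
  | zero => simp
  | succ e ih =>
    obtain ⟨g, rfl⟩ := h g ((dvd_pow_self p e.succ_ne_zero).trans hg)
    rw [mul_left_comm, pow_succ', mul_dvd_mul_iff_left hp] at hg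
    rw [pow_succ', mul_dvd_mul_iff_left hp]
    exact ih hg

lemma pow_dvd_of_dvd_pow_mul {p w : R} (hp : p ≠ 0) (h : ∀ g, p ∣ w * g → p ∣ g) (e e' : ℕ) {g : R}
    (hg : p ^ e ∣ w ^ e' * g) : p ^ e ∣ g := by
  induction e' generalizing g with
  | zero => simpa using hg
  | succ e' ih =>
    rw [pow_succ, mul_assoc] at hg
    exact pow_dvd_of_dvd_mul hp h e (ih hg)

lemma prod_pow_dvd {α : Type*} (T : Finset α) {p : α → R} (hp : ∀ i ∈ T, p i ≠ 0)
    (h : ∀ i ∈ T, ∀ j ∈ T, i ≠ j → ∀ g, p i ∣ p j * g → p i ∣ g) (e : α → ℕ) {g : R}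
    (hg : ∀ i ∈ T, p i ^ e i ∣ g) : ∏ i ∈ T, p i ^ e i ∣ g := by
  classical
  induction T using Finset.induction_on generalizing g with
  | empty => simp
  | insert a T ha ih =>
    rw [Finset.prod_insert ha]
    obtain ⟨g, rfl⟩ := hg a (by simp)
    refine mul_dvd_mul_left _ (ih (fun i hi => hp i (by simp [hi]))
      (fun i hi j hj => h i (by simp [hi]) j (by simp [hj])) fun i hi => ?_)
    exact pow_dvd_of_dvd_pow_mul (hp i (by simp [hi])) (h i (by simp [hi]) a (by simp)
      (by rintro rfl; exact ha hi)) _ _ (hg i (by simp [hi]))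

end Divisibility

/-- No two vertices of `S` are joined in the quiver of `B`. -/
def IsIndependent {n m : ℕ} (B : ExtMatrix n m) (S : Finset (Fin n)) : Prop :=
  ∀ i ∈ S, ∀ j ∈ S, B (Sum.inl i) j = 0

namespace SeedData

variable {K F : Type*} [Field K] [Field F] [Algebra K F] {n m : ℕ}

variable (K) in
/-- The algebra generated by the variables of a seed, the inverses of those outside `S`, and the
mutations of those in `S`. -/
def partialAlgebra (s : SeedData F n m) (S : Finset (Fin n)) : Subalgebra K F :=
  Algebra.adjoin K (Set.range s.x ∪ {z | ∃ i, (∀ l ∈ S, i ≠ Sum.inl l) ∧ z = (s.x i)⁻¹} ∪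
    {z | ∃ i ∈ S, z = (s.mutate i).x (Sum.inl i)})

/-- The exponents at the vertices of `S`. -/
def restrictExponent (S : Finset (Fin n)) : (Fin n ⊕ Fin m → ℤ) →+ (S → ℤ) where
  toFun β := fun l => β (Sum.inl l.1)
  map_zero' := rfl
  map_add' _ _ := rfl

lemma isDegreeZero_exchangePoly {B : ExtMatrix n m} {S : Finset (Fin n)} (hS : IsIndependent B S)
    {i : Fin n} (hi : i ∈ S) : IsDegreeZero (restrictExponent (m := m) S) (exchangePoly K B i) := by
  refine (isDegreeZero_single ?_ 1).add (isDegreeZero_single ?_ 1) <;> ext l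
  · simp [restrictExponent, posExponent, hS l l.2 i hi]
  · simp [restrictExponent, negExponent, hS l l.2 i hi]

lemma IsFullRankSeed.isDomain {s : SeedData F n m} (h : s.IsFullRankSeed K) :
    IsDomain (AddMonoidAlgebra K (Fin n ⊕ Fin m → ℤ)) :=
  h.laurentEval_injective.isDomain (laurentEval K s.x h.ne_zero).toRingHom

lemma IsFullRankSeed.exchangePoly_ne_zero {s : SeedData F n m} (h : s.IsFullRankSeed K)
    (k : Fin n) : exchangePoly K s.B k ≠ 0 := by
  intro h0
  apply h.exchangeValue_ne_zero k
  rw [← laurentEval_exchangePoly (K := K) s.B k h.ne_zero, h0, map_zero]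

lemma IsFullRankSeed.laurentMonomial_mutate {s : SeedData F n m} (h : s.IsFullRankSeed K)
    (i : Fin n) (γ : Fin n ⊕ Fin m → ℤ) :
    laurentMonomial (s.mutate i).x γ = exchangeValue s.B i s.x ^ γ (Sum.inl i) *
      laurentMonomial s.x (Function.update γ (Sum.inl i) (-γ (Sum.inl i))) := by
  have e1 : γ = Function.update γ (Sum.inl i) 0 + Pi.single (Sum.inl i) (γ (Sum.inl i)) := by
    ext l
    by_cases hl : l = Sum.inl i
    · subst hl; simp
    · simp [hl]
  have e2 : Function.update γ (Sum.inl i) (-γ (Sum.inl i)) =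
      Function.update γ (Sum.inl i) 0 + Pi.single (Sum.inl i) (-γ (Sum.inl i)) := by
    ext l
    by_cases hl : l = Sum.inl i
    · subst hl; simp
    · simp [hl]
  conv_lhs => rw [e1]
  rw [e2, laurentMonomial_add h.ne_zero, laurentMonomial_add (h.mutate i).ne_zero,
    laurentMonomial_single, laurentMonomial_single, mutate_x_self, div_zpow, zpow_neg]
  have : laurentMonomial (s.mutate i).x (Function.update γ (Sum.inl i) 0) =
      laurentMonomial s.x (Function.update γ (Sum.inl i) 0) := by
    refine laurentMonomial_congr fun l hl => mutate_x_of_ne s ?_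
    rintro rfl
    simp at hl
  rw [this]
  ring

/-- A Laurent polynomial in the mutated variables, multiplied by a high power of the exchange
polynomial, is a Laurent polynomial in the original variables with controlled components. -/
lemma IsFullRankSeed.exists_forall_dvd_component {s : SeedData F n m} (h : s.IsFullRankSeed K)
    {S : Finset (Fin n)} (hS : IsIndependent s.B S) (i : S) {z : F}
    (hz : z ∈ laurentSubalgebra K (s.mutate i).x) :
    ∃ N₀ : ℕ, ∀ N ≥ N₀, ∃ f, laurentEval K s.x h.ne_zero f = exchangeValue s.B i s.x ^ N * z ∧
      ∀ α : S → ℤ, exchangePoly K s.B i ^ (N - α i).toNat ∣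
        component (restrictExponent (m := m) S) α f := by
  classical
  rw [← range_laurentEval (h.mutate i).ne_zero] at hz
  obtain ⟨g, rfl⟩ := hz
  change ∃ N₀ : ℕ, ∀ N ≥ N₀, ∃ f, _ = _ * laurentEval K (s.mutate i).x (h.mutate i).ne_zero g ∧ _
  induction g using AddMonoidAlgebra.induction_linear with
  | zero => exact ⟨0, fun N _ => ⟨0, by simp, by simp⟩⟩
  | add g g' hg hg' =>
    obtain ⟨N₀, hN⟩ := hg
    obtain ⟨N₀', hN'⟩ := hg'
    refine ⟨max N₀ N₀', fun N hge => ?_⟩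
    obtain ⟨f, hf, hd⟩ := hN N (le_trans (le_max_left _ _) hge)
    obtain ⟨f', hf', hd'⟩ := hN' N (le_trans (le_max_right _ _) hge)
    refine ⟨f + f', by rw [map_add, map_add, hf, hf', mul_add], fun α => ?_⟩
    rw [map_add]
    exact dvd_add (hd α) (hd' α)
  | single γ c =>
    refine ⟨(-γ (Sum.inl i)).toNat, fun N hge => ?_⟩
    have hnn : 0 ≤ N + γ (Sum.inl i) := by omega
    refine ⟨exchangePoly K s.B i ^ (N + γ (Sum.inl i)).toNat *
      AddMonoidAlgebra.single (Function.update γ (Sum.inl i) (-γ (Sum.inl i))) c, ?_, fun α => ?_⟩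
    · rw [map_mul, map_pow, laurentEval_exchangePoly, laurentEval_single, laurentEval_single,
        h.laurentMonomial_mutate, ← zpow_natCast, ← zpow_natCast, Int.toNat_of_nonneg hnn,
        zpow_add₀ (h.exchangeValue_ne_zero i)]
      simp only [Algebra.smul_def]
      ring
    · rw [(isDegreeZero_exchangePoly hS i.2).pow, component_single]
      split_ifs with hα
      · have : α i = - γ (Sum.inl i) := by
          rw [← hα]; simp [restrictExponent]
        rw [this, sub_neg_eq_add]
        exact dvd_mul_right _ _
      · simp

/-- If a Laurent polynomial in the variables is also one in the variables mutated at `i`, then its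
component with exponent `-a` at `i` is divisible by the `a`-th power of the exchange polynomial. -/
lemma IsFullRankSeed.pow_dvd_component {s : SeedData F n m} (h : s.IsFullRankSeed K)
    {S : Finset (Fin n)} (hS : IsIndependent s.B S) (i : S)
    {g : AddMonoidAlgebra K (Fin n ⊕ Fin m → ℤ)}
    (hg : laurentEval K s.x h.ne_zero g ∈ laurentSubalgebra K (s.mutate i).x) (α : S → ℤ) :
    exchangePoly K s.B i ^ (-α i).toNat ∣ component (restrictExponent (m := m) S) α g := by
  have := h.isDomain
  obtain ⟨N, hN⟩ := h.exists_forall_dvd_component hS i hg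
  obtain ⟨f, hf, hd⟩ := hN N le_rfl
  rcases le_total 0 (α i) with h0 | h0
  · rw [Int.toNat_of_nonpos (by omega), pow_zero]; exact one_dvd _
  have hfg : f = exchangePoly K s.B i ^ N * g := by
    apply h.laurentEval_injective
    rw [hf, map_mul, map_pow, laurentEval_exchangePoly]
  have h1 := hd α
  rw [hfg, (isDegreeZero_exchangePoly hS i.2).pow,
    show ((N : ℤ) - α i).toNat = N + (-α i).toNat by omega, pow_add,
    mul_dvd_mul_iff_left (pow_ne_zero _ (h.exchangePoly_ne_zero i))] at h1
  exact h1

/-- For an independent set `S` the upper bound is contained in the algebra generated by the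
variables, the inverses of those outside `S`, and the mutations of those in `S`. The components for
the grading by the exponents at `S` are treated one by one, and the coprimality of the exchange
polynomials combines the divisibilities coming from the different elements of `S`. -/
theorem IsFullRankSeed.upperBound_le_partialAlgebra {s : SeedData F n m} (h : s.IsFullRankSeed K)
    {S : Finset (Fin n)} (hS : IsIndependent s.B S) :
    s.upperBound K ≤ s.partialAlgebra K S := by
  classical
  have := h.isDomain
  intro z hz
  rw [mem_upperBound, ← range_laurentEval h.ne_zero] at hz
  obtain ⟨⟨g, rfl⟩, hz⟩ := hz
  change laurentEval K s.x h.ne_zero g ∈ _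
  have hxmem (i) : s.x i ∈ s.partialAlgebra K S :=
    Algebra.subset_adjoin (Or.inl (Or.inl ⟨i, rfl⟩))
  have hinv (i) (hi : ∀ l ∈ S, i ≠ Sum.inl l) : (s.x i)⁻¹ ∈ s.partialAlgebra K S :=
    Algebra.subset_adjoin (Or.inl (Or.inr ⟨i, hi, rfl⟩))
  have hmut (i) (hi : i ∈ S) : (s.mutate i).x (Sum.inl i) ∈ s.partialAlgebra K S :=
    Algebra.subset_adjoin (Or.inr ⟨i, hi, rfl⟩)
  obtain ⟨D, -, hD⟩ := exists_finset_component (restrictExponent (m := m) S) g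
  rw [hD, map_sum]
  refine sum_mem fun α _ => ?_
  obtain ⟨f, hf⟩ : ∏ i : S, exchangePoly K s.B i ^ (-α i).toNat ∣
      component (restrictExponent (m := m) S) α g :=
    prod_pow_dvd (p := fun i : S => exchangePoly K s.B i) Finset.univ
      (fun i _ => h.exchangePoly_ne_zero i)
      (fun i _ j _ hij g => h.hasLeftInverse.exchangePoly_dvd fun heq => hij (Subtype.ext heq))
      (fun i => (-α i).toNat) fun i _ => h.pow_dvd_component hS i (hz i) α
  have hdeg : IsDegreeZero (restrictExponent (m := m) S)
      (∏ i : S, exchangePoly K s.B i ^ (-α i).toNat) :=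
    IsDegreeZero.prod _ fun i _ => (isDegreeZero_exchangePoly hS i.2).pow _
  rw [← component_component, hf, hdeg]
  clear hf
  induction f using AddMonoidAlgebra.induction_linear with
  | zero => simp [zero_mem]
  | add f f' hf hf' => rw [map_add, mul_add, map_add]; exact add_mem hf hf'
  | single γ c =>
    rw [component_single]
    split_ifs with hγ
    · rw [map_mul, laurentEval_single, mul_smul_comm, map_prod]
      refine Subalgebra.smul_mem _ ?_ c
      have hprod : ∏ i : S, laurentEval K s.x h.ne_zero (exchangePoly K s.B i ^ (-α i).toNat) =
          ∏ i : Fin n, if i ∈ S then exchangeValue s.B i s.x ^ (-γ (Sum.inl i)).toNat else 1 := by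
        rw [← Finset.prod_filter, Finset.filter_mem_eq_inter, Finset.univ_inter,
          ← Finset.prod_coe_sort S]
        refine Finset.prod_congr rfl fun i _ => ?_
        rw [map_pow, laurentEval_exchangePoly, ← hγ]
        rfl
      rw [hprod, laurentMonomial, Fintype.prod_sum_type, ← mul_assoc, ← Finset.prod_mul_distrib]
      refine mul_mem (prod_mem fun i _ => ?_) (prod_mem fun i _ => ?_)
      · split_ifs with hi
        · rcases le_total 0 (γ (Sum.inl i)) with h0 | h0
          · rw [Int.toNat_of_nonpos (by omega), pow_zero, one_mul]
            lift γ (Sum.inl i) to ℕ using h0 with a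
            rw [zpow_natCast]
            exact pow_mem (hxmem _) _
          · obtain ⟨a, ha⟩ := Int.eq_ofNat_of_zero_le (neg_nonneg.2 h0)
            have : γ (Sum.inl i) = -a := by omega
            rw [ha, Int.toNat_natCast, this, zpow_neg, zpow_natCast, ← div_eq_mul_inv, ← div_pow,
              ← mutate_x_self]
            exact pow_mem (hmut i hi) _
        · rw [one_mul]
          exact zpow_mem_of_inv_mem (hxmem _)
            (hinv _ fun l hl => by rintro heq; exact hi (Sum.inl_injective heq ▸ hl)) _
      · exact zpow_mem_of_inv_mem (hxmem _) (hinv _ fun l hl => by simp) _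
    · simp [zero_mem]

end SeedData

/-! ### Points of the cluster variety -/

section Acyclic

variable {n m : ℕ}

/-- If a point satisfies the exchange relations of an acyclic seed and its frozen coordinates do not
vanish, then its vanishing mutable coordinates are independent: otherwise, at a source of the
quiver restricted to them, exactly one monomial of the exchange polynomial would vanish. -/
lemma isIndependent_of_exchange {K : Type*} [Field K] {B : ExtMatrix n m}
    (hB : IsExtendedExchange B) (hac : IsAcyclic B) {a : Fin n ⊕ Fin m → K} {a' : Fin n → K}
    (hfr : ∀ j, a (Sum.inr j) ≠ 0) (hex : ∀ k, a (Sum.inl k) * a' k = exchangeValue B k a)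
    {S : Finset (Fin n)} (hS : ∀ i, i ∈ S ↔ a (Sum.inl i) = 0) : IsIndependent B S := by
  by_contra hnot
  have hex' : ∃ i ∈ S, ∃ l ∈ S, quiverRel B i l := by
    simp only [IsIndependent, not_forall] at hnot
    obtain ⟨i, hi, l, hl, hne⟩ := hnot
    rcases lt_or_gt_of_ne hne with h | h
    · refine ⟨l, hl, i, hi, ?_⟩
      have := hB l i
      rw [quiverRel]
      omega
    · exact ⟨i, hi, l, hl, h⟩
  have hwf : WellFounded (Relation.TransGen (quiverRel B)) := by
    have : Std.Irrefl (Relation.TransGen (quiverRel B)) := ⟨hac⟩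
    have : IsTrans (Fin n) (Relation.TransGen (quiverRel B)) :=
      ⟨fun _ _ _ => Relation.TransGen.trans⟩
    exact Finite.wellFounded_of_trans_of_irrefl _
  obtain ⟨i, ⟨hi, l, hl, hil⟩, hmin⟩ := hwf.has_min {i | i ∈ S ∧ ∃ l ∈ S, quiverRel B i l} hex'
  have h0 := hex i
  rw [(hS i).1 hi, zero_mul, exchangeValue] at h0
  have h1 : ∏ j, a j ^ (-B j i).toNat = 0 := by
    apply Finset.prod_eq_zero (Finset.mem_univ (Sum.inl l))
    rw [(hS l).1 hl, zero_pow]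
    have := hB l i
    rw [quiverRel] at hil
    omega
  rw [h1, add_zero] at h0
  obtain ⟨j, -, hj⟩ := Finset.prod_eq_zero_iff.1 h0.symm
  have hj0 : a j = 0 := eq_zero_of_pow_eq_zero hj
  have hpos : 0 < B j i := by
    by_contra hle
    rw [Int.toNat_of_nonpos (by omega), pow_zero] at hj
    exact one_ne_zero hj
  rcases j with j | j
  · exact hmin j ⟨(hS j).2 hj0, i, hi, hpos⟩ (Relation.TransGen.single hpos)
  · exact hfr j hj0

end Acyclic

namespace SeedData

variable {K F : Type*} [Field K] [Field F] [Algebra K F] {n m : ℕ}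

/-- Points of an algebra containing the variables of a seed and their mutations are determined by
their values on these elements. -/
lemma algHom_eq_of_forall_eq {s : SeedData F n m} {A : Subalgebra K F}
    (hx : ∀ i, s.x i ∈ A) (hx' : ∀ k, (s.mutate k).x (Sum.inl k) ∈ A) (h0 : ∀ i, s.x i ≠ 0)
    {φ ψ : A →ₐ[K] K} (h : ∀ i, φ ⟨s.x i, hx i⟩ = ψ ⟨s.x i, hx i⟩)
    (h' : ∀ k, φ ⟨_, hx' k⟩ = ψ ⟨_, hx' k⟩)
    {S : Finset (Fin n)} (hS : ∀ i, φ ⟨s.x i, hx i⟩ = 0 → ∃ l ∈ S, i = Sum.inl l)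
    (hA : A ≤ s.partialAlgebra K S) : φ = ψ := by
  classical
  let V : Subalgebra K F := Algebra.adjoin K
    (Set.range s.x ∪ Set.range fun k => (s.mutate k).x (Sum.inl k))
  have hVx (i) : s.x i ∈ V := Algebra.subset_adjoin (Or.inl ⟨i, rfl⟩)
  have hVx' (k) : (s.mutate k).x (Sum.inl k) ∈ V := Algebra.subset_adjoin (Or.inr ⟨k, rfl⟩)
  have hV : V ≤ (AlgHom.equalizer φ ψ).map A.val := by
    refine Algebra.adjoin_le ?_
    rintro _ (⟨i, rfl⟩ | ⟨k, rfl⟩)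
    · exact ⟨⟨s.x i, hx i⟩, h i, rfl⟩
    · exact ⟨⟨_, hx' k⟩, h' k, rfl⟩
  -- A power of the product `w` of the variables outside `S` clears the denominators of elements of
  -- `A`, and `w` does not vanish at `φ` and `ψ`.
  let T : Finset (Fin n ⊕ Fin m) := Finset.univ.filter fun i => ∀ l ∈ S, i ≠ Sum.inl l
  let w : F := ∏ i ∈ T, s.x i
  have hwV : w ∈ V := prod_mem fun i _ => hVx i
  have hwA : w ∈ A := prod_mem fun i _ => hx i
  have hφw : φ ⟨w, hwA⟩ ≠ 0 := by
    have : (⟨w, hwA⟩ : A) = ∏ i ∈ T, ⟨s.x i, hx i⟩ := by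
      ext; simp [w]
    rw [this, map_prod, Finset.prod_ne_zero_iff]
    intro i hi hi0
    obtain ⟨l, hl, rfl⟩ := hS i hi0
    exact (Finset.mem_filter.1 hi).2 l hl rfl
  have hψw : φ ⟨w, hwA⟩ = ψ ⟨w, hwA⟩ := by
    obtain ⟨w', hw', heq⟩ := hV hwV
    have : w' = ⟨w, hwA⟩ := Subtype.ext heq
    rw [← this]
    exact hw'
  ext z
  obtain ⟨N, hN⟩ : ∃ N : ℕ, w ^ N * (z : F) ∈ V := by
    refine exists_pow_mul_mem hwV ?_ (hA z.2)
    rintro g ((⟨i, rfl⟩ | ⟨i, hi, rfl⟩) | ⟨i, -, rfl⟩)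
    · exact mul_mem hwV (hVx i)
    · have hiT : i ∈ T := Finset.mem_filter.2 ⟨Finset.mem_univ _, hi⟩
      change (∏ i ∈ T, s.x i) * _ ∈ V
      rw [← Finset.mul_prod_erase T s.x hiT, mul_right_comm, mul_inv_cancel₀ (h0 i), one_mul]
      exact prod_mem fun i _ => hVx i
    · exact mul_mem hwV (hVx' i)
  obtain ⟨y, hy, heq⟩ := hV hN
  have hy' : y = ⟨w, hwA⟩ ^ N * z := Subtype.ext (by simpa using heq)
  have hy2 : φ y = ψ y := hy
  rw [hy', map_mul, map_mul, map_pow, map_pow, ← hψw] at hy2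
  exact mul_left_cancel₀ (pow_ne_zero N hφw) hy2

/-- Specialization: a point of the Laurent ring over the fraction field of `R`, given by nonzero
elements of `R`, restricts to a point over `R` of every algebra whose generators take values in `R`,
and can then be reduced by an augmentation `ε` of `R`. -/
lemma exists_algHom_of_specialization {s : SeedData F n m} (h : s.IsFullRankSeed K)
    {S : Finset (Fin n)} {A : Subalgebra K F} (hA : A ≤ s.partialAlgebra K S)
    {R : Type*} [CommRing R] [IsDomain R] [Algebra K R] (ε : R →ₐ[K] K)
    {y : Fin n ⊕ Fin m → R} (hy : ∀ i, y i ≠ 0) (hyu : ∀ i, (∀ l ∈ S, i ≠ Sum.inl l) → IsUnit (y i))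
    {y' : Fin n → R} (hy' : ∀ l ∈ S, y (Sum.inl l) * y' l = exchangeValue s.B l y) :
    ∃ φ : A →ₐ[K] K, (∀ i (hi : s.x i ∈ A), φ ⟨s.x i, hi⟩ = ε (y i)) ∧
      ∀ l ∈ S, ∀ hl : (s.mutate l).x (Sum.inl l) ∈ A, φ ⟨_, hl⟩ = ε (y' l) := by
  let Q := FractionRing R
  let ι : R →ₐ[K] Q := IsScalarTower.toAlgHom K R Q
  have hι : Function.Injective ι := IsFractionRing.injective R Q
  have hyQ (i) : ι (y i) ≠ 0 := (map_ne_zero_iff ι hι).2 (hy i)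
  let e := AlgEquiv.ofInjective (laurentEval K s.x h.ne_zero) h.laurentEval_injective
  let f : (laurentEval K s.x h.ne_zero).range →ₐ[K] Q :=
    (laurentEval K (fun i => ι (y i)) hyQ).comp e.symm.toAlgHom
  have hmem (i) : s.x i ∈ (laurentEval K s.x h.ne_zero).range := by
    rw [range_laurentEval]; exact mem_laurentSubalgebra _ _
  have hmem' (i) : (s.x i)⁻¹ ∈ (laurentEval K s.x h.ne_zero).range := by
    rw [range_laurentEval]; exact inv_mem_laurentSubalgebra _ _
  have hfx (i) : f ⟨s.x i, hmem i⟩ = ι (y i) := by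
    have : (⟨s.x i, hmem i⟩ : (laurentEval K s.x h.ne_zero).range) =
        e (AddMonoidAlgebra.single (Pi.single i 1) 1) := by
      apply Subtype.ext
      change s.x i = laurentEval K s.x h.ne_zero _
      rw [laurentEval_single, laurentMonomial_single, one_smul, zpow_one]
    rw [this]
    change laurentEval K _ hyQ (e.symm (e _)) = _
    rw [e.symm_apply_apply, laurentEval_single, laurentMonomial_single, one_smul, zpow_one]
  have hfinv (i) : f ⟨(s.x i)⁻¹, hmem' i⟩ = (ι (y i))⁻¹ := by
    refine eq_inv_of_mul_eq_one_left ?_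
    rw [← hfx, ← map_mul, ← map_one f]
    congr 1
    exact Subtype.ext (inv_mul_cancel₀ (h.ne_zero i))
  have hmutmem (l) : (s.mutate l).x (Sum.inl l) ∈ (laurentEval K s.x h.ne_zero).range := by
    rw [mutate_x_self, div_eq_mul_inv]
    exact mul_mem (ClusterAlg.exchangeValue_mem hmem _ _) (hmem' _)
  have hfmut (l) (hl : l ∈ S) : f ⟨_, hmutmem l⟩ = ι (y' l) := by
    apply mul_left_cancel₀ (hyQ (Sum.inl l))
    rw [← map_mul ι, hy' l hl, map_exchangeValue, ← hfx, ← map_mul]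
    have : (⟨s.x (Sum.inl l), hmem _⟩ * ⟨_, hmutmem l⟩ : (laurentEval K s.x h.ne_zero).range) =
        exchangeValue s.B l fun i => ⟨s.x i, hmem i⟩ := by
      apply Subtype.ext
      change s.x (Sum.inl l) * (s.mutate l).x (Sum.inl l) =
        (laurentEval K s.x h.ne_zero).range.val (exchangeValue s.B l fun i => ⟨s.x i, hmem i⟩)
      rw [map_exchangeValue, mutate_x_self, mul_div_cancel₀ _ (h.ne_zero _)]
      rfl
    rw [this, map_exchangeValue]
    simp only [hfx]
  have hle : s.partialAlgebra K S ≤ (ι.range.comap f).map (Subalgebra.val _) := by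
    refine Algebra.adjoin_le ?_
    rintro z ((⟨i, rfl⟩ | ⟨i, hi, rfl⟩) | ⟨i, hi, rfl⟩)
    · exact ⟨⟨_, hmem i⟩, ⟨y i, (hfx i).symm⟩, rfl⟩
    · refine ⟨⟨_, hmem' i⟩, ?_, rfl⟩
      obtain ⟨u, hu⟩ := hyu i hi
      refine ⟨(u⁻¹ : Rˣ), ?_⟩
      change ι _ = f _
      rw [hfinv, ← hu]
      refine eq_inv_of_mul_eq_one_left ?_
      rw [← map_mul, Units.inv_mul, map_one]
    · exact ⟨⟨_, hmutmem i⟩, ⟨y' i, (hfmut i hi).symm⟩, rfl⟩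
  have hAr : A ≤ (laurentEval K s.x h.ne_zero).range := by
    intro z hz
    obtain ⟨z', -, rfl⟩ := hle (hA hz)
    exact z'.2
  let g : A →ₐ[K] Q := f.comp (Subalgebra.inclusion hAr)
  have hg (z : A) : g z ∈ ι.range := by
    obtain ⟨z', hz', heq⟩ := hle (hA z.2)
    have : z' = Subalgebra.inclusion hAr z := Subtype.ext heq
    rw [this] at hz'
    exact hz'
  let e' := AlgEquiv.ofInjective ι hι
  refine ⟨ε.comp (e'.symm.toAlgHom.comp (g.codRestrict ι.range hg)), fun i hi => ?_,
    fun l hl hl' => ?_⟩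
  · have : g ⟨s.x i, hi⟩ = ι (y i) := hfx i
    have h2 : g.codRestrict ι.range hg ⟨s.x i, hi⟩ = e' (y i) := Subtype.ext this
    change ε (e'.symm (g.codRestrict ι.range hg ⟨s.x i, hi⟩)) = _
    rw [h2, e'.symm_apply_apply]
  · have : g ⟨_, hl'⟩ = ι (y' l) := hfmut l hl
    have h2 : g.codRestrict ι.range hg ⟨_, hl'⟩ = e' (y' l) := Subtype.ext this
    change ε (e'.symm (g.codRestrict ι.range hg ⟨_, hl'⟩)) = _
    rw [h2, e'.symm_apply_apply]

end SeedData

section Curve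

open PowerSeries

variable {K : Type*} [Field K] {n m : ℕ}

lemma zpow_finsetSum {G α : Type*} [CommGroup G] (a : G) (s : Finset α) (f : α → ℤ) :
    a ^ (∑ i ∈ s, f i) = ∏ i ∈ s, a ^ f i := by
  classical
  induction s using Finset.induction_on with
  | empty => simp
  | insert b s hb ih => rw [Finset.sum_insert hb, Finset.prod_insert hb, zpow_add, ih]

/-- The homomorphism of tori given by the columns of a full rank matrix is surjective. -/
lemma HasLeftInverse.exists_prod_zpow_eq {G G' : Type*} [CommGroup G] [Group G']
    {B : ExtMatrix n m} (h : HasLeftInverse B) (v : Fin n → G) (ε : G →* G')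
    (hε : ∀ i, ε (v i) = 1) :
    ∃ u : Fin n ⊕ Fin m → G, (∀ l, ∏ j, u j ^ B j l = v l) ∧ ∀ j, ε (u j) = 1 := by
  obtain ⟨C, hC⟩ := h
  refine ⟨fun j => ∏ i, v i ^ C i j, fun l => ?_, fun j => ?_⟩
  · have h1 (i : Fin n) : ∏ j, (v i ^ C i j) ^ B j l = v i ^ (if i = l then (1 : ℤ) else 0) := by
      have := congrFun (congrFun hC i) l
      rw [Matrix.mul_apply, Matrix.one_apply] at this
      rw [← this, zpow_finsetSum]
      exact Finset.prod_congr rfl fun j _ => (zpow_mul _ _ _).symm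
    simp only [← Finset.prod_zpow]
    rw [Finset.prod_comm, Finset.prod_congr rfl fun i _ => h1 i, Finset.prod_eq_single l]
    · simp
    · intro i _ hi; simp [hi]
    · simp
  · have : ∏ i, v i ^ C i j ∈ ε.ker :=
      prod_mem fun i _ => zpow_mem (MonoidHom.mem_ker.2 (hε i)) _
    exact this

/-- Every solution of the exchange relations whose vanishing coordinates are independent is the
value at `0` of a formal curve of solutions whose other points have no vanishing coordinates. The
coordinates at `S` are equal to the parameter `X`; the full rank condition allows to prescribe the
monomials of the columns in `S` along the curve, and thereby the limits of the mutated variables. -/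
lemma HasLeftInverse.exists_curve {B : ExtMatrix n m} (h : HasLeftInverse B)
    {a : Fin n ⊕ Fin m → K} {a' : Fin n → K}
    (hex : ∀ k, a (Sum.inl k) * a' k = exchangeValue B k a) {S : Finset (Fin n)}
    (hS : IsIndependent B S) (hS0 : ∀ i ∈ S, a (Sum.inl i) = 0)
    (hS1 : ∀ i, (∀ l ∈ S, i ≠ Sum.inl l) → a i ≠ 0) :
    ∃ (y : Fin n ⊕ Fin m → K⟦X⟧) (y' : Fin n → K⟦X⟧), (∀ i, y i ≠ 0) ∧
      (∀ i, (∀ l ∈ S, i ≠ Sum.inl l) → IsUnit (y i)) ∧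
      (∀ l ∈ S, y (Sum.inl l) * y' l = exchangeValue B l y) ∧
      (∀ i, constantCoeff (y i) = a i) ∧ ∀ l ∈ S, constantCoeff (y' l) = a' l := by
  classical
  set M : Fin n → K := fun l => ∏ j, a j ^ (-B j l).toNat with hM
  -- Along the curve the exchange polynomial at `l ∈ S` is `M l * c l * X` up to a factor with
  -- constant coefficient one, so that `y' l` has constant coefficient `M l * c l = a' l`.
  set c : Fin n → K := fun l => a' l / M l with hc
  have hv (l : Fin n) : ∃ v : K⟦X⟧ˣ, (v : K⟦X⟧) = 1 - C (c l) * X := by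
    have : IsUnit (1 - C (c l) * X : K⟦X⟧) := by
      rw [isUnit_iff_constantCoeff]; simp
    exact this
  choose v hv using hv
  let ε : K⟦X⟧ˣ →* Kˣ := Units.map (constantCoeff (R := K)).toMonoidHom
  have hε (l) : ε (v l) = 1 := by
    ext
    change constantCoeff (v l : K⟦X⟧) = 1
    rw [hv]; simp
  obtain ⟨u, hu, hεu⟩ := h.exists_prod_zpow_eq v ε hε
  have hu1 (j) : constantCoeff (u j : K⟦X⟧) = 1 := congrArg Units.val (hεu j)
  set U : Fin n → K⟦X⟧ˣ := fun l => ∏ j, u j ^ (-B j l).toNat with hU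
  have hUv (l) : ∏ j, u j ^ (B j l).toNat = U l * v l := by
    rw [← hu l, hU, ← Finset.prod_mul_distrib]
    refine Finset.prod_congr rfl fun j _ => ?_
    rw [← zpow_natCast, ← zpow_natCast, ← zpow_add]
    congr 1
    omega
  have hU1 (l) : constantCoeff (U l : K⟦X⟧) = 1 := by
    simp [hU, hu1]
  have hM0 (l) (hl : l ∈ S) : M l ≠ 0 := by
    rw [hM, Finset.prod_ne_zero_iff]
    intro j _
    by_cases hj : ∀ i ∈ S, j ≠ Sum.inl i
    · exact pow_ne_zero _ (hS1 j hj)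
    · push Not at hj
      obtain ⟨i, hi, rfl⟩ := hj
      rw [hS i hi l hl]; simp
  refine ⟨fun i => if ∀ l ∈ S, i ≠ Sum.inl l then C (a i) * u i else X,
    fun l => C (M l * c l) * U l, fun i => ?_, fun i hi => ?_, fun l hl => ?_, fun i => ?_,
    fun l hl => ?_⟩
  · dsimp only
    split_ifs with hi
    · exact mul_ne_zero (by rw [Ne, map_eq_zero_iff _ C_injective]; exact hS1 i hi) (u i).ne_zero
    · exact X_ne_zero
  · dsimp only
    rw [if_pos hi]
    exact ((isUnit_iff_ne_zero.2 (hS1 i hi)).map C).mul (u i).isUnit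
  · have e0 : ∏ j, a j ^ (B j l).toNat = - M l := by
      have := hex l
      rw [hS0 l hl, zero_mul, exchangeValue] at this
      exact eq_neg_of_add_eq_zero_left this.symm
    rw [exchangeValue_congr (B' := B) (a' := fun j => C (a j) * (u j : K⟦X⟧)) (fun _ => rfl)]
    · dsimp only
      rw [if_neg (by simpa using hl), exchangeValue]
      have e1 : ∏ j, (C (a j) * (u j : K⟦X⟧)) ^ (B j l).toNat = C (- M l) * (U l * v l) := by
        rw [← Units.val_mul, ← hUv, ← e0]
        simp [mul_pow, Finset.prod_mul_distrib]
      have e2 : ∏ j, (C (a j) * (u j : K⟦X⟧)) ^ (-B j l).toNat = C (M l) * U l := by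
        simp [mul_pow, Finset.prod_mul_distrib, hM, hU]
      rw [e1, e2, hv, map_mul, map_neg]
      ring
    · intro j hj
      rw [if_pos]
      rintro i hi rfl
      exact hj (hS i hi l hl)
  · dsimp only
    split_ifs with hi
    · simp [hu1]
    · push Not at hi
      obtain ⟨l, hl, rfl⟩ := hi
      simp [hS0 l hl]
  · simp [hU1, hc, mul_div_cancel₀ _ (hM0 l hl)]

end Curve

section Points

variable {K F : Type*} [Field K] [Field F] [Algebra K F] {n m : ℕ}

/-- The solutions of the exchange relations at a seed with nonvanishing frozen coordinates: the
first component collects the values of the variables, the second one those of their mutations. -/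
def exchangeSolutions (K : Type*) [Field K] (B : ExtMatrix n m) :
    Set ((Fin n ⊕ Fin m → K) × (Fin n → K)) :=
  {p | (∀ j, p.1 (Sum.inr j) ≠ 0) ∧ ∀ k, p.1 (Sum.inl k) * p.2 k = exchangeValue B k p.1}

/-- For an acyclic seed of full rank, the points of the cluster variety are the solutions of the
exchange relations. -/
theorem SeedData.IsFullRankSeed.card_algHom {s : SeedData F n m} (h : s.IsFullRankSeed K)
    (hac : IsAcyclic s.B) {A : Subalgebra K F} (hx : ∀ i, s.x i ∈ A)
    (hx' : ∀ k, (s.mutate k).x (Sum.inl k) ∈ A) (hinv : ∀ j, (s.x (Sum.inr j))⁻¹ ∈ A)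
    (hA : A ≤ s.upperBound K) : Nat.card (A →ₐ[K] K) = Nat.card (exchangeSolutions K s.B) := by
  classical
  have hsol (φ : A →ₐ[K] K) : ((fun i => φ ⟨s.x i, hx i⟩), fun k => φ ⟨_, hx' k⟩) ∈
      exchangeSolutions K s.B := by
    refine ⟨fun j => ?_, fun k => ?_⟩
    · have : φ ⟨_, hx (Sum.inr j)⟩ * φ ⟨_, hinv j⟩ = 1 := by
        rw [← map_mul, ← map_one φ]
        congr 1
        exact Subtype.ext (mul_inv_cancel₀ (h.ne_zero _))
      exact left_ne_zero_of_mul_eq_one this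
    · dsimp only
      rw [← map_mul, ← map_exchangeValue φ s.B k (fun i => (⟨s.x i, hx i⟩ : A))]
      congr 1
      apply Subtype.ext
      change s.x (Sum.inl k) * (s.mutate k).x (Sum.inl k) =
        A.val (exchangeValue s.B k fun i => (⟨s.x i, hx i⟩ : A))
      rw [map_exchangeValue, mutate_x_self, mul_div_cancel₀ _ (h.ne_zero _)]
      rfl
  have hindep (p) (hp : p ∈ exchangeSolutions K s.B) :
      IsIndependent s.B (Finset.univ.filter fun i => p.1 (Sum.inl i) = 0) :=
    isIndependent_of_exchange h.isSeed.exchange hac hp.1 hp.2 (by simp)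
  refine Nat.card_congr (Equiv.ofBijective (fun φ => ⟨_, hsol φ⟩) ⟨fun φ ψ heq => ?_, ?_⟩)
  · have heq' := Subtype.ext_iff.1 heq
    rw [Prod.ext_iff] at heq'
    have hp := hsol φ
    refine algHom_eq_of_forall_eq hx hx' h.ne_zero (congrFun heq'.1) (congrFun heq'.2) ?_
      (hA.trans (h.upperBound_le_partialAlgebra (hindep _ hp)))
    rintro (i | j) hi
    · exact ⟨i, by simpa using hi, rfl⟩
    · exact absurd hi (hp.1 j)
  · rintro ⟨⟨a, a'⟩, hp⟩
    have hS1 (i) (hi : ∀ l ∈ Finset.univ.filter (fun i => a (Sum.inl i) = 0), i ≠ Sum.inl l) :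
        a i ≠ 0 := by
      rcases i with i | j
      · intro h0
        exact hi i (by simpa using h0) rfl
      · exact hp.1 j
    obtain ⟨y, y', hy, hyu, hy', hya, hya'⟩ := h.hasLeftInverse.exists_curve (a' := a') hp.2
      (hindep _ hp) (by simp) hS1
    let ε : PowerSeries K →ₐ[K] K :=
      { PowerSeries.constantCoeff with
        commutes' := fun r => by
          change PowerSeries.constantCoeff (algebraMap K (PowerSeries K) r) = r
          rw [PowerSeries.algebraMap_apply, PowerSeries.constantCoeff_C]; rfl }
    obtain ⟨φ, hφ, hφ'⟩ := exists_algHom_of_specialization h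
      (hA.trans (h.upperBound_le_partialAlgebra (hindep _ hp))) ε hy hyu hy'
    have h1 (i) : φ ⟨s.x i, hx i⟩ = a i := (hφ i (hx i)).trans (hya i)
    refine ⟨φ, Subtype.ext (Prod.ext (funext h1) (funext fun k => ?_))⟩
    by_cases hk : a (Sum.inl k) = 0
    · have hk' : k ∈ Finset.univ.filter (fun i => a (Sum.inl i) = 0) := by simpa using hk
      exact (hφ' k hk' (hx' k)).trans (hya' k hk')
    · have e1 := (hsol φ).2 k
      have e2 := hp.2 k
      dsimp only at e1 e2 ⊢
      rw [funext h1, ← e2, h1] at e1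
      exact mul_left_cancel₀ hk e1

end Points

/-! ### Counting -/

section Counting

lemma card_fiber_mul_card {G H : Type*} [Group G] [Group H] [Finite G] [Finite H]
    (χ : G →* H) (hχ : Function.Surjective χ) (y : H) :
    Nat.card {g // χ g = y} * Nat.card H = Nat.card G := by
  classical
  have := Fintype.ofFinite H
  have := Fintype.ofFinite G
  have h1 (y' : H) : Nat.card {g // χ g = y'} = Nat.card {g // χ g = y} := by
    rw [Nat.card_eq_fintype_card, Nat.card_eq_fintype_card, Fintype.card_subtype,
      Fintype.card_subtype]
    exact MonoidHom.card_fiber_eq_of_mem_range χ (hχ y') (hχ y)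
  rw [← Nat.card_congr (Equiv.sigmaFiberEquiv χ), Nat.card_sigma,
    Finset.sum_congr rfl fun y' _ => h1 y']
  simp [mul_comm]

variable {K : Type*} [Field K] {n m : ℕ}

/-- The vertices outside `S`, including the frozen ones. -/
abbrev OutsideOf (n m : ℕ) (S : Finset (Fin n)) : Type :=
  {i : Fin n ⊕ Fin m // ∀ l ∈ S, i ≠ Sum.inl l}

lemma card_outsideOf (S : Finset (Fin n)) : Nat.card (OutsideOf n m S) + S.card = n + m := by
  classical
  have h1 : Nat.card (OutsideOf n m S) =
      (Finset.univ \ S.map (Function.Embedding.inl (β := Fin m))).card := by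
    rw [Nat.card_eq_fintype_card]
    refine Fintype.card_of_subtype _ fun i => ?_
    simp only [Finset.mem_sdiff, Finset.mem_univ, true_and, Finset.mem_map, not_exists, not_and]
    exact forall₂_congr fun l _ => ne_comm
  have h2 := Finset.card_sdiff_add_card_eq_card
    (Finset.subset_univ (S.map (Function.Embedding.inl (β := Fin m))))
  rw [← h1, Finset.card_map, Finset.card_univ, Fintype.card_sum, Fintype.card_fin,
    Fintype.card_fin] at h2
  exact h2

variable (K) in
/-- The homomorphism of tori given by the columns in `S`. -/
def columnHom (B : ExtMatrix n m) (S : Finset (Fin n)) :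
    (OutsideOf n m S → Kˣ) →* (S → Kˣ) where
  toFun g := fun l => ∏ j, g j ^ B j l
  map_one' := by ext; simp
  map_mul' g g' := by ext; simp [mul_zpow, Finset.prod_mul_distrib]

lemma prod_outsideOf {M : Type*} [CommMonoid M] {S : Finset (Fin n)} {f : Fin n ⊕ Fin m → M}
    (hf : ∀ l ∈ S, f (Sum.inl l) = 1) : ∏ j, f j = ∏ j : OutsideOf n m S, f j := by
  classical
  rw [← Finset.prod_subtype (Finset.univ.filter fun i => ∀ l ∈ S, i ≠ Sum.inl l) (by simp)]
  refine (Finset.prod_subset (Finset.filter_subset _ _) fun j _ hj => ?_).symm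
  simp only [Finset.mem_filter, Finset.mem_univ, true_and, not_forall] at hj
  obtain ⟨l, hl, hj⟩ := hj
  rw [not_not.1 hj, hf l hl]

lemma columnHom_surjective {B : ExtMatrix n m} (h : HasLeftInverse B) {S : Finset (Fin n)}
    (hS : IsIndependent B S) : Function.Surjective (columnHom K B S) := by
  classical
  intro v
  obtain ⟨u, hu, -⟩ := h.exists_prod_zpow_eq (G' := Kˣ)
    (fun l => if hl : l ∈ S then v ⟨l, hl⟩ else 1) 1 (fun _ => rfl)
  refine ⟨fun j => u j, funext fun l => ?_⟩
  have := hu l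
  rw [dif_pos l.2, prod_outsideOf fun i hi => by rw [hS i hi l l.2, zpow_zero]] at this
  exact this

lemma exchangeValue_eq_zero_iff {B : ExtMatrix n m} {S : Finset (Fin n)} (hS : IsIndependent B S)
    {a : Fin n ⊕ Fin m → K} {g : OutsideOf n m S → Kˣ} (hg : ∀ j : OutsideOf n m S, a j = g j)
    (l : S) : exchangeValue B l a = 0 ↔ columnHom K B S g l = -1 := by
  have e1 : ∏ j, a j ^ (B j l).toNat = ((∏ j, g j ^ (B j l).toNat : Kˣ) : K) := by
    rw [prod_outsideOf fun i hi => by rw [hS i hi l l.2]; simp]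
    simp [hg]
  have e2 : ∏ j, a j ^ (-B j l).toNat = ((∏ j, g j ^ (-B j l).toNat : Kˣ) : K) := by
    rw [prod_outsideOf fun i hi => by rw [hS i hi l l.2]; simp]
    simp [hg]
  have e3 : ∏ j, g j ^ (B j l).toNat = columnHom K B S g l * ∏ j, g j ^ (-B j l).toNat := by
    change _ = (∏ j, g j ^ B j l) * _
    rw [← Finset.prod_mul_distrib]
    refine Finset.prod_congr rfl fun j _ => ?_
    rw [← zpow_natCast, ← zpow_natCast, ← zpow_add]
    congr 1
    omega
  rw [exchangeValue, e1, e2, e3, Units.val_mul, ← add_one_mul, mul_eq_zero,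
    or_iff_left (Units.ne_zero _), Units.ext_iff, Units.val_neg, Units.val_one]
  exact eq_neg_iff_add_eq_zero.symm

open Classical in
/-- The vanishing mutable coordinates of a point. -/
noncomputable def vanishingSet (p : (Fin n ⊕ Fin m → K) × (Fin n → K)) : Finset (Fin n) :=
  Finset.univ.filter fun i => p.1 (Sum.inl i) = 0

lemma mem_vanishingSet {p : (Fin n ⊕ Fin m → K) × (Fin n → K)} {i : Fin n} :
    i ∈ vanishingSet p ↔ p.1 (Sum.inl i) = 0 := by simp [vanishingSet]

/-- Solutions of the exchange relations with a given independent vanishing set: the mutated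
variables at `S` are free, and the coordinates outside `S` lie in a fiber of the homomorphism of
tori given by the columns in `S`. -/
lemma card_exchangeSolutions_vanishingSet_eq {B : ExtMatrix n m} {S : Finset (Fin n)}
    (hS : IsIndependent B S) :
    Nat.card {p : exchangeSolutions K B // vanishingSet p.1 = S} =
      Nat.card ((S → K) × {g : OutsideOf n m S → Kˣ // columnHom K B S g = -1}) := by
  classical
  let a (g : OutsideOf n m S → Kˣ) : Fin n ⊕ Fin m → K := fun i =>
    if hi : ∀ l ∈ S, i ≠ Sum.inl l then g ⟨i, hi⟩ else 0
  have ha (g) (j : OutsideOf n m S) : a g j = g j := dif_pos j.2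
  have ha0 (g) (l) : a g (Sum.inl l) = 0 ↔ l ∈ S := by
    simp only [a]
    split_ifs with h
    · refine iff_of_false (Units.ne_zero _) fun hl => h l hl rfl
    · push Not at h
      obtain ⟨i, hi, heq⟩ := h
      exact iff_of_true rfl (Sum.inl_injective heq ▸ hi)
  let a' (b : S → K) (g : OutsideOf n m S → Kˣ) : Fin n → K := fun l =>
    if hl : l ∈ S then b ⟨l, hl⟩ else exchangeValue B l (a g) / a g (Sum.inl l)
  have hsol (b : S → K) (g : OutsideOf n m S → Kˣ) (hg : columnHom K B S g = -1) :
      (a g, a' b g) ∈ exchangeSolutions K B := by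
    refine ⟨fun j => ?_, fun l => ?_⟩
    · have := ha g ⟨Sum.inr j, by simp⟩
      dsimp only at this ⊢
      rw [this]
      exact Units.ne_zero _
    · dsimp only
      by_cases hl : l ∈ S
      · rw [(ha0 g l).2 hl, zero_mul]
        exact ((exchangeValue_eq_zero_iff hS (ha g) ⟨l, hl⟩).2 (congrFun hg _)).symm
      · simp only [a', dif_neg hl]
        rw [mul_div_cancel₀]
        rwa [Ne, ha0]
  symm
  refine Nat.card_congr (Equiv.ofBijective (fun bg => ⟨⟨(a bg.2, a' bg.1 bg.2),
    hsol bg.1 bg.2.1 bg.2.2⟩, ?_⟩) ⟨?_, ?_⟩)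
  · ext i
    rw [mem_vanishingSet]
    exact ha0 _ _
  · rintro ⟨b, g, hg⟩ ⟨b', g', hg'⟩ heq
    have h1 : a g = a g' := congrArg (fun p => p.1.1.1) heq
    have h2 : a' b g = a' b' g' := congrArg (fun p => p.1.1.2) heq
    have hgg : g = g' := by
      ext j
      rw [← ha g, ← ha g', h1]
    have hbb : b = b' := by
      ext l
      have := congrFun h2 l
      simpa [a'] using this
    subst hgg hbb
    rfl
  · rintro ⟨⟨⟨x, x'⟩, hfr, hex⟩, hvan⟩
    dsimp only at hfr hex hvan
    have hx0 (l) : x (Sum.inl l) = 0 ↔ l ∈ S := by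
      rw [← hvan, mem_vanishingSet]
    have hx1 (j : OutsideOf n m S) : x j ≠ 0 := by
      rcases j with ⟨i | i, hi⟩
      · exact fun h0 => hi i ((hx0 i).1 h0) rfl
      · exact hfr i
    let g : OutsideOf n m S → Kˣ := fun j => Units.mk0 (x j) (hx1 j)
    have hax : a g = x := by
      ext i
      by_cases hi : ∀ l ∈ S, i ≠ Sum.inl l
      · exact ha g ⟨i, hi⟩
      · push Not at hi
        obtain ⟨l, hl, rfl⟩ := hi
        rw [(ha0 g l).2 hl, (hx0 l).2 hl]
    have hcol : columnHom K B S g = -1 := by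
      funext l
      refine (exchangeValue_eq_zero_iff hS (a := x) (fun j => rfl) l).1 ?_
      rw [← hex, (hx0 _).2 l.2, zero_mul]
    refine ⟨⟨fun l => x' l, g, hcol⟩, Subtype.ext (Subtype.ext (Prod.ext hax (funext fun l => ?_)))⟩
    by_cases hl : l ∈ S
    · simp [a', hl]
    · simp only [a', dif_neg hl, hax]
      have : x (Sum.inl l) ≠ 0 := by rwa [Ne, hx0]
      rw [← hex, mul_div_cancel_left₀ _ this]

lemma card_exchangeSolutions_vanishingSet [Finite K] {B : ExtMatrix n m} (h : HasLeftInverse B)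
    {S : Finset (Fin n)} (hS : IsIndependent B S) :
    (Nat.card {p : exchangeSolutions K B // vanishingSet p.1 = S} : ℚ) =
      (Nat.card K : ℚ) ^ S.card * ((Nat.card K : ℚ) - 1) ^ ((n : ℤ) + m - 2 * S.card) := by
  have hq : ((Nat.card K : ℚ) - 1) ≠ 0 := by
    have : 1 < Nat.card K := Finite.one_lt_card
    have : (1 : ℚ) < Nat.card K := by exact_mod_cast this
    linarith
  have hu : (Nat.card Kˣ : ℚ) = (Nat.card K : ℚ) - 1 := by
    rw [Nat.card_units, Nat.cast_sub Nat.card_pos, Nat.cast_one]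
  have h1 := card_fiber_mul_card (columnHom K B S) (columnHom_surjective h hS) (-1)
  rw [Nat.card_fun, Nat.card_fun] at h1
  have h2 := card_outsideOf (m := m) S
  rw [card_exchangeSolutions_vanishingSet_eq hS, Nat.card_prod, Nat.card_fun,
    Nat.cast_mul, Nat.cast_pow, Nat.card_eq_fintype_card (α := S), Fintype.card_coe]
  congr 1
  rw [Nat.card_eq_fintype_card (α := S), Fintype.card_coe] at h1
  have h3 := congrArg (Nat.cast (R := ℚ)) h1
  rw [Nat.cast_mul, Nat.cast_pow, Nat.cast_pow, hu] at h3
  have h4 : (n : ℤ) + m - 2 * S.card = (Nat.card (OutsideOf n m S) : ℤ) - (S.card : ℤ) := by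
    have : ((Nat.card (OutsideOf n m S) + S.card : ℕ) : ℤ) = ((n + m : ℕ) : ℤ) := by rw [h2]
    push_cast at this
    linarith
  rw [h4, zpow_sub₀ hq, zpow_natCast, zpow_natCast, ← h3,
    mul_div_cancel_right₀ _ (pow_ne_zero _ hq)]

lemma isNIndepSet_iff {B : ExtMatrix n m} (hB : IsExtendedExchange B) {S : Finset (Fin n)}
    {k : ℕ} : (quiverGraph B).IsNIndepSet k S ↔ IsIndependent B S ∧ S.card = k := by
  rw [SimpleGraph.isNIndepSet_iff]
  refine and_congr_left fun _ => ⟨fun h i hi j hj => ?_, fun h i hi j hj _ hadj => ?_⟩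
  · by_cases hij : i = j
    · subst hij; exact hB.diag i
    · have h1 := h hi hj hij
      rw [quiverGraph, SimpleGraph.fromRel_adj, quiverRel, quiverRel] at h1
      have := hB i j
      push Not at h1
      have := h1 hij
      omega
  · rw [quiverGraph, SimpleGraph.fromRel_adj, quiverRel, quiverRel, h i hi j hj, h j hj i hi] at hadj
    simp at hadj

/-- The number of solutions of the exchange relations of an acyclic seed of full rank. -/
theorem card_exchangeSolutions [Finite K] {B : ExtMatrix n m} (hB : IsExtendedExchange B)
    (h : HasLeftInverse B) (hac : IsAcyclic B) :
    (Nat.card (exchangeSolutions K B) : ℚ) =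
      ∑ k ∈ Finset.range (n + 1), ((anticliques B k).ncard : ℚ) *
        (Nat.card K : ℚ) ^ k * ((Nat.card K : ℚ) - 1) ^ ((n : ℤ) + (m : ℤ) - 2 * (k : ℤ)) := by
  classical
  rw [← Nat.card_congr (Equiv.sigmaFiberEquiv fun p : exchangeSolutions K B => vanishingSet p.1),
    Nat.card_sigma, Nat.cast_sum]
  have h0 (S : Finset (Fin n)) (hS : ¬ IsIndependent B S) :
      Nat.card {p : exchangeSolutions K B // vanishingSet p.1 = S} = 0 := by
    rw [Nat.card_eq_zero]
    refine Or.inl ⟨fun p => hS ?_⟩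
    rw [← p.2]
    exact isIndependent_of_exchange hB hac p.1.2.1 p.1.2.2 fun i => mem_vanishingSet
  rw [← Finset.sum_filter_of_ne (p := IsIndependent B) fun S _ hne => by
    by_contra hS
    exact hne (by rw [h0 S hS, Nat.cast_zero])]
  rw [← Finset.sum_fiberwise_of_maps_to (t := Finset.range (n + 1)) (g := Finset.card)
    fun S _ => Finset.mem_range.2 (Nat.lt_succ_of_le (card_finset_fin_le S))]
  refine Finset.sum_congr rfl fun k _ => ?_
  have h1 : anticliques B k =
      ((Finset.univ.filter (IsIndependent B)).filter fun S => S.card = k : Finset _) := by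
    ext S
    simp [anticliques, isNIndepSet_iff hB]
  rw [h1, Set.ncard_coe_finset, mul_assoc, ← nsmul_eq_mul, ← Finset.sum_const]
  refine Finset.sum_congr rfl fun S hS => ?_
  rw [Finset.mem_filter, Finset.mem_filter] at hS
  rw [card_exchangeSolutions_vanishingSet h hS.1.2, hS.2]

end Counting

end ClusterAlg

theorem mainTheorem6 {K F : Type*} [Field K] [Finite K] [Field F] [Algebra K F] {n m : ℕ}
    (t₀ : ClusterAlg.SeedData F n m) (hseed : t₀.IsSeed K)
    (hrank : ClusterAlg.IsReallyFullRank t₀.B)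
    (t : ClusterAlg.SeedData F n m) (ht : t₀.MutatesTo t) (hacyclic : ClusterAlg.IsAcyclic t.B) :
    (Nat.card (t₀.ClusterVarietyPoints K) : ℚ) =
      ∑ k ∈ Finset.range (n + 1), ((ClusterAlg.anticliques t.B k).ncard : ℚ) *
        (Nat.card K : ℚ) ^ k * ((Nat.card K : ℚ) - 1) ^ ((n : ℤ) + (m : ℤ) - 2 * (k : ℤ)) := by
  have h₀ : t₀.IsFullRankSeed K := ⟨hseed, hrank.hasLeftInverse⟩
  have h := h₀.of_mutatesTo ht
  rw [← ClusterAlg.card_exchangeSolutions h.isSeed.exchange h.hasLeftInverse hacyclic]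
  congr 1
  refine h.card_algHom hacyclic (fun i => ?_) (fun k => ?_) (fun j => ?_)
    (h₀.clusterAlgebra_le_upperBound ht)
  · exact Algebra.subset_adjoin (Or.inl ⟨t, ht, i, rfl⟩)
  · exact Algebra.subset_adjoin (Or.inl ⟨t.mutate k, ht.tail ⟨k, rfl⟩, Sum.inl k, rfl⟩)
  · exact Algebra.subset_adjoin (Or.inr ⟨j, by rw [ht.x_inr]⟩)
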